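/- Let $G$ be a connected, simply connected, simple linear algebraic group over $\mathbb{C}$ with centre $Z$, let $A\subset G$ be a maximal torus, let $R\subset X^*(A)$ be the root system of $G$ with respect to $A$, and let $W$ be the Weyl group of $(G,A)$, i.e. the (finite) group of automorphisms of $A$ generated by the reflections $s_\alpha(a)=a\cdot\alpha^\vee(\alpha(a))^{-1}$, $\alpha\in R$ (it is the group $N_G(A)/A$ acting on $A$ by conjugation). Simply connected means that the coroots generate the cocharacter lattice $X_*(A)$. Fix simple roots $\{\alpha_i\}_{i\in I}$ and let $\{\varpi_i\}_{i\in I}\subset X^*(A)$ be the fundamental weights, i.e. the basis dual to the simple coroots $\{\alpha_i^\vee\}_{i\in I}$. An element $u\in A$ is called regular if its stabilizer in $W$ is trivial. For $g\in W$ and $x\in Z\ (\subset A)$ put $$A(g,x)=\{u\in A\mid g(u)=xu\},\qquad a(x)=\#\{i\in I\mid \varpi_i(x)=1\}.$$ Dimension and connected components refer to the Zariski topology, and the empty set does not have dimension $\ge 0$. Let $x\in Z$. For every $g\in W$ the following conditions are equivalent: (i) $\dim A(g,x)=a(x)$; (ii) $A(g,x)$ contains a regular element; (iii) $A(g,x)$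 is non-empty and every connected component of $A(g,x)$ contains a regular element. Moreover, the elements $g\in W$ satisfying these conditions form a single (in particular, non-empty) conjugacy class of $W$. -/

import Mathlib

open scoped IsMulCommutative

namespace AlgTorus

noncomputable section

/-! ### Zariski topology and linear algebraic groups over the complex numbers -/

/-- Polynomial functions in the matrix entries, evaluated on `GL N`. -/
def evalEntries {N : ℕ} (p : MvPolynomial (Fin N × Fin N) ℂ) (g : GL (Fin N) ℂ) : ℂ :=
  MvPolynomial.eval (fun ij => (g : Matrix (Fin N) (Fin N) ℂ) ij.1 ij.2) p

/-- The Zariski topology on `GL N` over `ℂ`: the sets `{p ≠ 0}`, for `p` a polynomial in the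
entries, form a basis. (Negative powers of `det` would give no further sets.) -/
abbrev zariskiGL (N : ℕ) : TopologicalSpace (GL (Fin N) ℂ) :=
  TopologicalSpace.generateFrom
    (Set.range fun p : MvPolynomial (Fin N × Fin N) ℂ => {g | evalEntries p g ≠ 0})

/-- The Zariski topology on a subgroup of `GL N`. -/
abbrev zariski {N : ℕ} (H : Subgroup (GL (Fin N) ℂ)) : TopologicalSpace H :=
  (zariskiGL N).induced Subtype.val

/-- `H` is a Zariski closed subgroup of `GL N`, i.e. a linear algebraic group. -/
def IsZariskiClosed {N : ℕ} (H : Subgroup (GL (Fin N) ℂ)) : Prop :=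
  @IsClosed _ (zariskiGL N) (H : Set (GL (Fin N) ℂ))

/-- `H` is connected in the Zariski topology. -/
def IsZariskiConnected {N : ℕ} (H : Subgroup (GL (Fin N) ℂ)) : Prop :=
  @IsConnected _ (zariskiGL N) (H : Set (GL (Fin N) ℂ))

/-- A simple algebraic group (in the sense of algebraic groups: the centre may be a nontrivial
finite group): closed, connected, noncommutative, and without closed connected normal subgroups
other than the trivial group and the whole group. -/
structure IsSimpleAlgebraicGroup {N : ℕ} (G : Subgroup (GL (Fin N) ℂ)) : Prop where
  closed : IsZariskiClosed G
  connected : IsZariskiConnected G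
  noncomm : ∃ g ∈ G, ∃ h ∈ G, g * h ≠ h * g
  simple : ∀ H : Subgroup (GL (Fin N) ℂ), H ≤ G → IsZariskiClosed H → IsZariskiConnected H →
    (∀ g ∈ G, ∀ h ∈ H, g * h * g⁻¹ ∈ H) → H = ⊥ ∨ H = G

/-- A complex-valued function on `H ≤ GL N` is regular if it is a polynomial in the entries of
`h` and of `h⁻¹`. -/
def IsRegularFun {N : ℕ} (H : Subgroup (GL (Fin N) ℂ)) (f : H → ℂ) : Prop :=
  ∃ p : MvPolynomial ((Fin N × Fin N) ⊕ (Fin N × Fin N)) ℂ, ∀ h : H,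
    f h = MvPolynomial.eval
      (Sum.elim
        (fun ij => ((h : GL (Fin N) ℂ) : Matrix (Fin N) (Fin N) ℂ) ij.1 ij.2)
        (fun ij => (((h : GL (Fin N) ℂ)⁻¹ : GL (Fin N) ℂ) : Matrix (Fin N) (Fin N) ℂ) ij.1 ij.2))
      p

/-- A complex-valued function on `(ℂˣ)ʳ` is regular if it is a Laurent polynomial. -/
def IsLaurentFun {r : ℕ} (f : (Fin r → ℂˣ) → ℂ) : Prop :=
  ∃ p : MvPolynomial (Fin r ⊕ Fin r) ℂ, ∀ t : Fin r → ℂˣ,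
    f t = MvPolynomial.eval
      (Sum.elim (fun i => (t i : ℂ)) (fun i => (((t i)⁻¹ : ℂˣ) : ℂ))) p

/-- `A` is an algebraic torus: a closed subgroup of `GL N` that is isomorphic, as an algebraic
group, to `(ℂˣ)ʳ` for some `r`. -/
def IsTorus {N : ℕ} (A : Subgroup (GL (Fin N) ℂ)) : Prop :=
  IsZariskiClosed A ∧ ∃ (r : ℕ) (e : (Fin r → ℂˣ) ≃* A),
    (∀ i j, IsLaurentFun fun t => ((e t : GL (Fin N) ℂ) : Matrix (Fin N) (Fin N) ℂ) i j) ∧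
    (∀ k, IsRegularFun A fun a => ((e.symm a k : ℂˣ) : ℂ))

/-- `A` is a maximal torus of `G`. -/
structure IsMaximalTorus {N : ℕ} (G A : Subgroup (GL (Fin N) ℂ)) : Prop where
  le : A ≤ G
  torus : IsTorus A
  maximal : ∀ T : Subgroup (GL (Fin N) ℂ), T ≤ G → IsTorus T → A ≤ T → T = A

/-- The Lie algebra of `G`, as the Zariski tangent space at the identity: the matrices `X` such
that the derivative at `1` in the direction `X` of every polynomial vanishing on `G` is zero. -/
def lieAlg {N : ℕ} (G : Subgroup (GL (Fin N) ℂ)) : Set (Matrix (Fin N) (Fin N) ℂ) :=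
  {X | ∀ p : MvPolynomial (Fin N × Fin N) ℂ, (∀ g ∈ G, evalEntries p g = 0) →
    ∑ ij : Fin N × Fin N, X ij.1 ij.2 * evalEntries (MvPolynomial.pderiv ij p) 1 = 0}

/-! ### Characters, cocharacters, roots and the root datum -/

/-- The character group `X^*(A)`: the regular homomorphisms `A → ℂˣ`, written additively. -/
def Characters {N : ℕ} (A : Subgroup (GL (Fin N) ℂ)) : AddSubgroup (Additive (A →* ℂˣ)) where
  carrier := {χ | IsRegularFun A fun a => (χ.toMul a : ℂ)}
  zero_mem' := ⟨1, fun a => by simp⟩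
  add_mem' := by
    rintro χ ψ ⟨p, hp⟩ ⟨q, hq⟩
    exact ⟨p * q, fun a => by rw [map_mul, ← hp, ← hq]; simp⟩
  neg_mem' := by
    rintro χ ⟨p, hp⟩
    refine ⟨MvPolynomial.rename Sum.swap p, fun a => ?_⟩
    have h : ((χ.toMul a⁻¹ : ℂˣ) : ℂ) = _ := hp a⁻¹
    change (((χ.toMul a)⁻¹ : ℂˣ) : ℂ) = _
    rw [← map_inv, h, MvPolynomial.eval_rename]
    congr 2
    funext s
    rcases s with s | s <;> simp

theorem IsLaurentFun.sum_mul {r : ℕ} {κ : Type*} (s : Finset κ)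
    {f g : κ → (Fin r → ℂˣ) → ℂ} (hf : ∀ k, IsLaurentFun (f k)) (hg : ∀ k, IsLaurentFun (g k)) :
    IsLaurentFun fun t => ∑ k ∈ s, f k t * g k t := by
  choose p hp using hf
  choose q hq using hg
  exact ⟨∑ k ∈ s, p k * q k, fun t => by simp [hp, hq]⟩

theorem IsLaurentFun.comp_inv {r : ℕ} {f : (Fin r → ℂˣ) → ℂ} (hf : IsLaurentFun f) :
    IsLaurentFun fun t => f t⁻¹ := by
  obtain ⟨p, hp⟩ := hf
  refine ⟨MvPolynomial.rename Sum.swap p, fun t => ?_⟩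
  change f t⁻¹ = _
  rw [MvPolynomial.eval_rename, hp]
  congr 2
  funext s
  rcases s with s | s <;> simp

/-- The cocharacter group `X_*(A)`: the homomorphisms `ℂˣ → A` of algebraic groups (the matrix
entries are Laurent polynomials), written additively. -/
def Cocharacters {N : ℕ} (A : Subgroup (GL (Fin N) ℂ)) [IsMulCommutative A] :
    AddSubgroup (Additive (ℂˣ →* A)) where
  carrier := {l | ∀ i j, IsLaurentFun (r := 1) fun t =>
    ((l.toMul (t 0) : GL (Fin N) ℂ) : Matrix (Fin N) (Fin N) ℂ) i j}
  zero_mem' := fun i j =>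
    ⟨MvPolynomial.C ((1 : Matrix (Fin N) (Fin N) ℂ) i j), fun t => by simp⟩
  add_mem' := by
    intro l m hl hm i j
    have h := IsLaurentFun.sum_mul Finset.univ (fun k => hl i k) (fun k => hm k j)
    simpa [Matrix.mul_apply] using h
  neg_mem' := by
    intro l hl i j
    have h := (hl i j).comp_inv
    simpa using h

/-- `α` is a root of `G` with respect to `A`: a nontrivial character of `A` that occurs in the
adjoint representation of `A` on the Lie algebra of `G`. -/
def IsRoot {N : ℕ} (G A : Subgroup (GL (Fin N) ℂ)) (α : Characters A) : Prop :=
  α ≠ 0 ∧ ∃ X ∈ lieAlg G, X ≠ 0 ∧ ∀ a : A,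
    ((a : GL (Fin N) ℂ) : Matrix (Fin N) (Fin N) ℂ) * X *
      (((a : GL (Fin N) ℂ)⁻¹ : GL (Fin N) ℂ) : Matrix (Fin N) (Fin N) ℂ) =
      (α.1.toMul a : ℂ) • X

section RootDatum

variable {N : ℕ} {A : Subgroup (GL (Fin N) ℂ)} [IsMulCommutative A] {ι : Type*}

/-- `P` is the root datum of `G` with respect to the maximal torus `A`: it is a root datum on
`X^*(A)` and `X_*(A)`, the pairing is the canonical one, `χ (l t) = t ^ ⟨χ, l⟩`, and the roots are
the roots of `G` with respect to `A`. -/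
structure IsRootDatumOf (G : Subgroup (GL (Fin N) ℂ))
    (P : RootDatum ι (Characters A) (Cocharacters A)) : Prop where
  pairing_eq : ∀ (χ : Characters A) (l : Cocharacters A) (t : ℂˣ),
    χ.1.toMul (l.1.toMul t) = t ^ P.toLinearMap χ l
  range_root : Set.range P.root = {α | IsRoot G A α}

/-- A semisimple group is simply connected if its cocharacter lattice is the coroot lattice
(equivalently, its character lattice is the full weight lattice). -/
def IsSimplyConnected (P : RootDatum ι (Characters A) (Cocharacters A)) : Prop :=
  Submodule.span ℤ (Set.range P.coroot) = ⊤

/-- The Weyl group `W`, as a group of automorphisms of the torus `A`: it is generated by the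
reflections `a ↦ a * α^∨(α(a))⁻¹` for the roots `α`. (It is the group `N_G(A)/A`, acting on `A`
by conjugation.) -/
def weylGroup (P : RootDatum ι (Characters A) (Cocharacters A)) : Subgroup (MulAut A) :=
  Subgroup.closure {s | ∃ i, ∀ a : A,
    s a = a * ((P.coroot i).1.toMul ((P.root i).1.toMul a))⁻¹}

/-- `ϖ` is the family of fundamental weights attached to the base `b` of simple roots: the family
dual to the simple coroots. -/
def IsFundamentalWeights (P : RootDatum ι (Characters A) (Cocharacters A)) (b : P.Base)
    (ϖ : b.support → Characters A) : Prop :=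
  (∀ i : b.support, P.toLinearMap (ϖ i) (P.coroot i) = 1) ∧
    ∀ i j : b.support, i ≠ j → P.toLinearMap (ϖ i) (P.coroot j) = 0

/-- `a(x)`: the number of `i` such that `ϖ i` is trivial on `x`. -/
def numTrivial {κ : Type*} (ϖ : κ → Characters A) (x : A) : ℕ :=
  {i : κ | (ϖ i).1.toMul x = 1}.ncard

/-- `u` is regular: its stabilizer in the Weyl group is trivial. -/
def IsRegular (P : RootDatum ι (Characters A) (Cocharacters A)) (u : A) : Prop :=
  ∀ w ∈ weylGroup P, w u = u → w = 1

/-- `A(g, x) = {u ∈ A | g(u) = x u}`. -/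
def eigenLocus (g : MulAut A) (x : A) : Set A := {u | g u = x * u}

/-- The dimension of a subset of `A`: the Krull dimension for the Zariski topology (`⊥` for the
empty set). -/
def zariskiDim (S : Set A) : WithBot ℕ∞ :=
  letI := zariski A
  topologicalKrullDim S

/-- The connected component of `u` in `S`, for the Zariski topology. -/
def zariskiComponent (S : Set A) (u : A) : Set A :=
  letI := zariski A
  connectedComponentIn S u

end RootDatum

end

end AlgTorus

/-!
The proof compares the loci `{u | g u = x u}` with an affine space, by means of the quotient of
the torus by the Weyl group.

The group algebra `ℂ[X]` of the character lattice is the coordinate ring of the torus. Since the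
fundamental weights `ϖ i` form a basis of `X` (`IsFundamentalWeights.isDualWeightBasis`), the
invariants of the Weyl group are the polynomials in the orbit sums `c i` of the `ϖ i`
(`exists_aeval_eq`). So `u ↦ (c i (u))` is a finite map from the torus to affine space that
separates the orbits (`exists_smul_eq_of_ev_orbitSum_eq`). The determinant of its Jacobian matrix
is a multiple of the Weyl denominator, both being alternating with the same leading term
(`jacobian_det_eq`). Hence the map is étale where no root is trivial, and those points are the
regular ones (`isRegularPoint_of_forall_ne`).

A central `x` multiplies `c i` by `ϖ i (x)`. On the locus of `g` the `c i` with `ϖ i (x) ≠ 1`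
vanish, and the others give a finite map from the locus to an affine space of dimension `a(x)`.
The locus therefore has dimension `a(x)` if and only if these `c i` are algebraically independent
on it, and then it is mapped onto this space, so it meets every orbit that meets the locus of some
element (`exists_smul_mem_locus`). If the locus contains a regular point then the `c i` are local
coordinates there, hence independent (`quotientMap_injective`). Consequently two elements whose
loci contain regular points are conjugate: a conjugate of one and the other multiply the same
regular point by `x`.

It remains to find regular points. Some locus is nonempty, as the origin of affine space is the
image of an orbit, which multiplication by `x` preserves. Among the elements with nonempty locus
take `g` with the largest fixed space on the Lie algebra of the torus. If a point of the locus of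
`g` is moved by the exponential of a generic fixed vector then it becomes regular: otherwise
multiplication of `g` by reflections in the roots that are trivial at the moved point would lead
to a larger fixed space (`exists_lt_fixedSpace`). If the locus of `g` contains a regular point
then étaleness determines the dimension of the fixed space (`finrank_fixedSpace`), so the fixed
space is as large as possible. Thus each point of such a locus is joined to a regular point by a
one-parameter family, which stays in the connected component.

These arguments take place in the group of characters of `X`. They are transferred to the given
torus by means of its coordinates (`TorusCoordinates`): its points are the characters of its
character group, by the linear independence of characters, and its Zariski topology is induced
from the spectrum of `ℂ[X]`, whence the dimension of a locus is the Krull dimension of its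
coordinate ring (`topologicalKrullDim_locus`). All roots are trivial on a central element of the
matrix group, because it acts trivially on the tangent space (`isCentralPoint_point`).
-/

namespace AlgTorus

noncomputable section

/-! ### Weyl groups of root data with fundamental weights -/

section WeylCombinatorics

open RootPairing

variable {ι X Y : Type*} [AddCommGroup X] [AddCommGroup Y]
  {P : RootPairing ι ℤ X Y} {b : P.Base} {ϖ : b.support → X}

open scoped Classical in
/-- `ϖ` is a `ℤ`-basis of the weight lattice, dual to the simple coroots. The existence of such a
family says that the coroots span the cocharacter lattice. -/
structure IsDualWeightBasis (b : P.Base) (ϖ : b.support → X) : Prop where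
  coroot'_apply : ∀ i j : b.support, P.coroot' j (ϖ i) = if i = j then 1 else 0
  sum_smul : ∀ l : X, ∑ j : b.support, P.coroot' j l • ϖ j = l

variable (P) in
/-- The reflection in the root with index `i`, as an element of the Weyl group. -/
abbrev refl (i : ι) : P.weylGroup := weylGroup.ofIdx P i

lemma refl_smul (i : ι) (l : X) : refl P i • l = l - P.coroot' i l • P.root i := rfl

lemma refl_smul_idx (i j : ι) : refl P i • j = P.reflectionPerm i j := rfl

lemma refl_mul_self (i : ι) : refl P i * refl P i = 1 := by
  apply Subtype.ext
  have := Equiv.reflection_inv P i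
  exact mul_eq_one_iff_inv_eq.mpr this

lemma refl_inv (i : ι) : (refl P i)⁻¹ = refl P i :=
  inv_eq_of_mul_eq_one_right (refl_mul_self i)

lemma smul_root (w : P.weylGroup) (i : ι) : w • P.root i = P.root (w • i) :=
  weylGroup_apply_root P w i

lemma coroot'_smul_smul (w : P.weylGroup) (i : ι) (l : X) :
    P.coroot' (w • i) (w • l) = P.coroot' i l := by
  obtain ⟨w, hw⟩ := w
  induction hw using weylGroup.induction generalizing i l with
  | mem j =>
    change P.coroot' (P.reflectionPerm j i) (P.reflection j l) = _
    rw [coroot'_reflection, reflectionPerm_self]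
  | one => rfl
  | mul x y hx hy hx' hy' =>
    have := hx' ((⟨y, hy⟩ : P.weylGroup) • i) ((⟨y, hy⟩ : P.weylGroup) • l)
    rw [hy'] at this
    exact this

lemma coroot'_smul (w : P.weylGroup) (i : ι) (l : X) :
    P.coroot' i (w • l) = P.coroot' (w⁻¹ • i) l := by
  rw [← coroot'_smul_smul w (w⁻¹ • i), smul_inv_smul]

lemma smul_zsmul' (w : P.weylGroup) (n : ℤ) (l : X) : w • (n • l) = n • (w • l) :=
  map_zsmul (DistribSMul.toAddMonoidHom X w) n l

/-- The Weyl group acts trivially on weights modulo the root lattice. -/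
lemma smul_sub_mem_closure (w : P.weylGroup) (l : X) :
    w • l - l ∈ AddSubgroup.closure (Set.range P.root) := by
  obtain ⟨w, hw⟩ := w
  induction hw using weylGroup.induction generalizing l with
  | mem j =>
    change refl P j • l - l ∈ _
    rw [refl_smul, sub_sub_cancel_left]
    exact neg_mem (zsmul_mem (AddSubgroup.subset_closure (Set.mem_range_self j)) _)
  | one =>
    change l - l ∈ _
    rw [sub_self]
    exact zero_mem _
  | mul x y hx hy hx' hy' =>
    have h := add_mem (hx' (y • l)) (hy' l)
    have e1 : (⟨y, hy⟩ : P.weylGroup) • l = y • l := rfl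
    have e2 : (⟨x, hx⟩ : P.weylGroup) • y • l = (⟨x * y, mul_mem hx hy⟩ : P.weylGroup) • l := rfl
    rwa [e1, e2, sub_add_sub_cancel] at h

lemma eq_one_of_forall_smul {w : P.weylGroup} (H : ∀ l : X, w • l = l) : w = 1 := by
  apply Subtype.ext
  apply Equiv.weightHom_injective P
  ext l
  exact H l

lemma refl_conj (w : P.weylGroup) (i : ι) : refl P (w • i) = w * refl P i * w⁻¹ := by
  rw [← inv_mul_eq_one]
  refine eq_one_of_forall_smul fun l => ?_
  rw [refl_inv, mul_smul, mul_smul, mul_smul, refl_smul i, smul_sub, smul_zsmul', smul_root,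
    smul_inv_smul, refl_smul, map_sub, map_zsmul, ← coroot'_smul_smul w i, smul_inv_smul,
    root_coroot'_eq_pairing, pairing_same, smul_eq_mul]
  module

lemma refl_smul_self (i : ι) (l : X) : P.coroot' (refl P i • i) l = - P.coroot' i l := by
  rw [refl_smul_idx, ← coroot'_reflection, reflection_apply, map_sub, map_zsmul,
    root_coroot'_eq_pairing, pairing_same, smul_eq_mul]
  ring

namespace IsDualWeightBasis

variable (h : IsDualWeightBasis b ϖ)
include h

lemma ext_coroot' {l m : X} (H : ∀ j : b.support, P.coroot' j l = P.coroot' j m) : l = m := by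
  rw [← h.sum_smul l, ← h.sum_smul m]
  simp only [H]

lemma coroot'_eq_sum (i : ι) (l : X) :
    P.coroot' i l = ∑ j : b.support, P.coroot' j l * P.coroot' i (ϖ j) := by
  conv_lhs => rw [← h.sum_smul l]
  simp [map_sum]

lemma finite_weylGroup [Finite ι] : Finite P.weylGroup := by
  refine Finite.of_injective (fun w : P.weylGroup => fun i : ι => w • i) fun v w hvw => ?_
  have hvw' : ∀ i, v • i = w • i := fun i => congrFun hvw i
  rw [← inv_mul_eq_one]
  refine eq_one_of_forall_smul fun l => h.ext_coroot' fun j => ?_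
  rw [← coroot'_smul_smul (v⁻¹ * w) j l]
  congr 2
  rw [mul_smul, ← hvw', inv_smul_smul]

lemma isAddTorsionFree_left : IsAddTorsionFree X where
  nsmul_right_injective n hn l m hlm := by
    refine h.ext_coroot' fun j => ?_
    have := congrArg (P.coroot' j) hlm
    simpa [hn] using this

omit h in
lemma isAddTorsionFree_right (P : RootPairing ι ℤ X Y) : IsAddTorsionFree Y where
  nsmul_right_injective n hn y z hyz := by
    apply P.toLinearMap.flip.toPerfPair.injective
    ext l
    have := congrArg (P.toLinearMap l) hyz
    simpa [hn] using this

omit h in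
/-- Every coroot is a nonnegative or a nonpositive combination of simple coroots, hence has constant
sign on the dominant weights. -/
lemma coroot_sign (i : ι) : (∀ l : X, (∀ j : b.support, 0 ≤ P.coroot' j l) → 0 ≤ P.coroot' i l) ∨
    (∀ l : X, (∀ j : b.support, 0 ≤ P.coroot' j l) → P.coroot' i l ≤ 0) := by
  have key : ∀ y ∈ AddSubmonoid.closure (P.coroot '' b.support), ∀ l : X,
      (∀ j : b.support, 0 ≤ P.coroot' j l) → 0 ≤ P.toLinearMap l y := by
    intro y hy l hl
    induction hy using AddSubmonoid.closure_induction with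
    | mem y hy =>
      obtain ⟨j, hj, rfl⟩ := hy
      exact hl ⟨j, hj⟩
    | zero => simp
    | add y z _ _ hy hz => rw [map_add]; exact add_nonneg hy hz
  rcases b.coroot_mem_or_neg_mem i with hi | hi
  · exact Or.inl fun l hl => key _ hi l hl
  · refine Or.inr fun l hl => ?_
    have := key _ hi l hl
    rw [map_neg] at this
    exact neg_nonneg.mp this

omit h in
variable (ϖ) in
/-- The weight `ρ`, defined as the sum of the fundamental weights. -/
def rho : X := ∑ i, ϖ i

omit h in
variable (ϖ) in
/-- The coroot with index `i` is positive: it takes a positive value on the sum of the fundamental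
weights. This means that it is a nonnegative combination of simple coroots. -/
def Pos (i : ι) : Prop := 0 < P.coroot' i (rho ϖ)

omit h in
/-- A weight is dominant if it is nonnegative on the simple coroots. -/
def _root_.AlgTorus.IsDominant (b : P.Base) (l : X) : Prop := ∀ j : b.support, 0 ≤ P.coroot' j l

lemma coroot'_rho (j : b.support) : P.coroot' j (rho ϖ) = 1 := by
  simp [rho, map_sum, h.coroot'_apply]

lemma isDominant_weight (i : b.support) : IsDominant b (ϖ i) := fun j => by
  rw [h.coroot'_apply]; split_ifs <;> simp

lemma isDominant_rho : IsDominant b (rho ϖ) := fun j => by rw [h.coroot'_rho]; simp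

lemma pos_simple (j : b.support) : Pos ϖ j := by
  rw [Pos, h.coroot'_rho]; exact one_pos

lemma Pos.nonneg {i : ι} (hi : Pos ϖ i) {l : X} (hl : IsDominant b l) : 0 ≤ P.coroot' i l := by
  rcases coroot_sign (b := b) i with H | H
  · exact H l hl
  · exact absurd (H _ h.isDominant_rho) (not_le.mpr hi)

lemma nonpos_of_not_pos {i : ι} (hi : ¬ Pos ϖ i) {l : X} (hl : IsDominant b l) :
    P.coroot' i l ≤ 0 := by
  rcases coroot_sign (b := b) i with H | H
  · have hsum : ∑ j, P.coroot' i (ϖ j) ≤ 0 := by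
      have := not_lt.mp hi
      rwa [rho, map_sum] at this
    have hn : ∀ j, 0 ≤ P.coroot' i (ϖ j) := fun j => H _ (h.isDominant_weight j)
    have hz : ∀ j, P.coroot' i (ϖ j) = 0 := fun j =>
      (Finset.sum_eq_zero_iff_of_nonneg fun j _ => hn j).mp
        (le_antisymm hsum (Finset.sum_nonneg fun j _ => hn j)) j (Finset.mem_univ j)
    rw [h.coroot'_eq_sum i l]
    simp [hz]
  · exact H l hl

lemma coroot'_rho_ne_zero (i : ι) : P.coroot' i (rho ϖ) ≠ 0 := by
  intro h0
  have h2 : ∀ j, P.coroot' i (ϖ j) = 0 := by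
    have hsum : ∑ j, P.coroot' i (ϖ j) = 0 := by rwa [rho, map_sum] at h0
    rcases coroot_sign (b := b) i with H | H
    · exact fun j => (Finset.sum_eq_zero_iff_of_nonneg fun j _ => H _ (h.isDominant_weight j)).mp
        hsum j (Finset.mem_univ j)
    · exact fun j => (Finset.sum_eq_zero_iff_of_nonpos fun j _ => H _ (h.isDominant_weight j)).mp
        hsum j (Finset.mem_univ j)
  have h3 := h.coroot'_eq_sum i (P.root i)
  simp [h2] at h3

lemma pos_refl_self_iff (i : ι) : Pos ϖ (refl P i • i) ↔ ¬ Pos ϖ i := by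
  have := h.coroot'_rho_ne_zero i
  rw [Pos, Pos, refl_smul_self]
  lia

/-- A simple reflection permutes the positive coroots other than its own. -/
lemma Pos.refl_smul [Finite ι] {i : ι} (hi : Pos ϖ i) (j : b.support) (hij : i ≠ j) :
    Pos ϖ (refl P (j : ι) • i) := by
  by_contra hneg
  -- all coefficients of `coroot i` other than the one at `j` vanish
  have hz : ∀ k, k ≠ j → P.coroot' i (ϖ k) = 0 := by
    intro k hk
    refine le_antisymm ?_ (Pos.nonneg h hi (h.isDominant_weight k))
    have h1 := h.nonpos_of_not_pos hneg (h.isDominant_weight k)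
    rwa [refl_smul_idx, ← coroot'_reflection, reflection_apply, h.coroot'_apply, if_neg hk,
      zero_smul, sub_zero] at h1
  have hc : ∀ l, P.coroot' i l = P.coroot' i (ϖ j) * P.coroot' j l := by
    intro l
    rw [h.coroot'_eq_sum i l, Finset.sum_eq_single j]
    · ring
    · intro k _ hk; rw [hz k hk, mul_zero]
    · simp
  have := h.isAddTorsionFree_left
  have : IsAddTorsionFree Y := isAddTorsionFree_right P
  have hc' : P.coroot i = P.coroot' i (ϖ j) • P.coroot (j : ι) := by
    apply P.toLinearMap.flip.toPerfPair.injective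
    ext l
    simpa using hc l
  have h1 := b.flip.eq_one_or_neg_one_of_mem_support_of_smul_mem j j.2 (P.coroot' i (ϖ j))
    ⟨i, hc'⟩
  have h2 : 0 < P.coroot' i (ϖ j) := by
    have := hc (rho ϖ)
    rw [h.coroot'_rho, mul_one] at this
    rw [← this]; exact hi
  have h3 : P.coroot' i (ϖ j) = 1 := by lia
  rw [h3, one_smul] at hc'
  exact hij (P.coroot.injective hc')

/-! ### Words in simple reflections -/

omit h in
/-- The product of a word in the simple reflections. -/
def word (L : List b.support) : P.weylGroup := (L.map fun j : b.support => refl P (j : ι)).prod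

omit h in
@[simp] lemma word_nil : word ([] : List b.support) = 1 := rfl

omit h in
@[simp] lemma word_cons (j : b.support) (L : List b.support) :
    word (j :: L) = refl P (j : ι) * word L := rfl

omit h in
lemma word_append (L M : List b.support) : word (L ++ M) = word L * word M := by
  simp [word]

omit h in
lemma word_reverse (L : List b.support) : word L.reverse = (word L)⁻¹ := by
  induction L with
  | nil => simp
  | cons j L ih =>
    rw [List.reverse_cons, word_append, ih, word_cons, word_cons, word_nil, mul_one, mul_inv_rev,
      refl_inv]

section Words

variable [Finite ι]

/-- The exchange condition: if `w`, given by a word, sends a simple coroot to a negative one, then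
`w s` for the corresponding reflection `s` is given by the word with a letter deleted. -/
lemma exists_word_mul_refl (L : List b.support) (j : b.support)
    (hj : ¬ Pos ϖ (word L • (j : ι))) :
    ∃ L' : List b.support, L'.length + 1 = L.length ∧ word L' = word L * refl P (j : ι) := by
  induction L with
  | nil => exact absurd (h.pos_simple j) (by simpa using hj)
  | cons a L ih =>
    by_cases hp : Pos ϖ (word L • (j : ι))
    · have ha : word L • (j : ι) = a := by
        by_contra hne
        exact hj (by rw [word_cons, mul_smul]; exact Pos.refl_smul h hp a hne)
      refine ⟨L, rfl, ?_⟩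
      rw [word_cons, ← ha, refl_conj]
      rw [inv_mul_cancel_right, mul_assoc, refl_mul_self, mul_one]
    · obtain ⟨L', hL', hw⟩ := ih hp
      exact ⟨a :: L', by simp [hL'], by rw [word_cons, hw, word_cons, mul_assoc]⟩

/-- Positive coroots are translates of simple ones: a simple reflection that decreases the value on
`ρ` exists as long as the coroot is not simple. -/
lemma exists_eq_word_smul {i : ι} (hi : Pos ϖ i) :
    ∃ (L : List b.support) (j : b.support), i = word L • (j : ι) := by
  generalize hn : (P.coroot' i (rho ϖ)).toNat = n
  induction n using Nat.strong_induction_on generalizing i with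
  | _ n ih =>
  by_cases hs : ∃ j : b.support, i = j
  · obtain ⟨j, hj⟩ := hs
    exact ⟨[], j, by simpa using hj⟩
  · push Not at hs
    have h2 := h.coroot'_eq_sum i (P.root i)
    rw [root_coroot'_eq_pairing, pairing_same] at h2
    obtain ⟨j, hj⟩ : ∃ j : b.support, 0 < P.coroot' j (P.root i) := by
      by_contra! hle
      have : ∑ j : b.support, P.coroot' j (P.root i) * P.coroot' i (ϖ j) ≤ 0 :=
        Finset.sum_nonpos fun j _ => mul_nonpos_of_nonpos_of_nonneg (hle j)
          (Pos.nonneg h hi (h.isDominant_weight j))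
      lia
    have hj' : 0 < P.coroot' i (P.root j) := by
      have e : ∀ k l, P.pairingIn ℤ k l = P.pairing k l := fun k l => by
        simpa using P.algebraMap_pairingIn ℤ k l
      rw [root_coroot'_eq_pairing, ← e] at hj ⊢
      exact (P.zero_lt_pairingIn_iff' ℤ).mp hj
    have hp := Pos.refl_smul h hi j (hs j)
    have hlt : P.coroot' (refl P (j : ι) • i) (rho ϖ) < P.coroot' i (rho ϖ) := by
      rw [refl_smul_idx, ← coroot'_reflection, reflection_apply, map_sub, h.coroot'_rho, one_smul]
      lia
    obtain ⟨L, k, hL⟩ := ih _ (by rw [Pos] at hp hi; lia) hp rfl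
    refine ⟨j :: L, k, ?_⟩
    rw [word_cons, mul_smul, ← hL, ← mul_smul, refl_mul_self, one_smul]

lemma exists_word_eq (w : P.weylGroup) : ∃ L : List b.support, word L = w := by
  have hpos : ∀ i, Pos ϖ i → ∃ L : List b.support, word L = refl P i := by
    intro i hi
    obtain ⟨L, j, rfl⟩ := h.exists_eq_word_smul hi
    exact ⟨L ++ [j] ++ L.reverse, by
      rw [word_append, word_append, word_reverse, refl_conj]; simp⟩
  have hrefl : ∀ i, ∃ L : List b.support, word L = refl P i := by
    intro i
    by_cases hi : Pos ϖ i
    · exact hpos i hi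
    · obtain ⟨L, hL⟩ := hpos _ ((h.pos_refl_self_iff i).mpr hi)
      exact ⟨L, by rw [hL, refl_conj]; simp⟩
  obtain ⟨w, hw⟩ := w
  induction hw using weylGroup.induction with
  | mem i => exact hrefl i
  | one => exact ⟨[], rfl⟩
  | mul x y hx hy hx' hy' =>
    obtain ⟨L, hL⟩ := hx'
    obtain ⟨M, hM⟩ := hy'
    exact ⟨L ++ M, by rw [word_append, hL, hM]; rfl⟩

/-- A Weyl group orbit contains at most one dominant weight. -/
lemma smul_eq_of_isDominant {w : P.weylGroup} {l : X} (hl : IsDominant b l)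
    (hwl : IsDominant b (w • l)) : w • l = l := by
  obtain ⟨L, rfl⟩ := h.exists_word_eq w
  generalize hn : L.length = n
  induction n using Nat.strong_induction_on generalizing L with
  | _ n ih =>
  -- a word that is not of minimal length is replaced by a shorter one
  by_cases hmin : ∃ L' : List b.support, L'.length < L.length ∧ word L' = word L
  · obtain ⟨L', hlt, hw⟩ := hmin
    rw [← hw] at hwl ⊢
    exact ih _ (hn ▸ hlt) L' hwl rfl
  rcases L.eq_nil_or_concat' with rfl | ⟨M, j, rfl⟩
  · simp
  have hw : word (M ++ [j]) = word M * refl P (j : ι) := by rw [word_append]; simp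
  -- a word of minimal length makes its last simple coroot negative
  have hneg : ¬ Pos ϖ (word (M ++ [j]) • (j : ι)) := by
    intro hp
    have hM : ¬ Pos ϖ (word M • (j : ι)) := by
      have hE : word (M ++ [j]) • (j : ι) = refl P (word M • (j : ι)) • (word M • (j : ι)) := by
        rw [refl_conj, hw]; simp [mul_smul]
      rw [hE] at hp
      exact (h.pos_refl_self_iff _).mp hp
    obtain ⟨L', hL', hw'⟩ := h.exists_word_mul_refl M j hM
    exact hmin ⟨L', by simp; lia, by rw [hw', hw]⟩
  have h0 : P.coroot' (j : ι) l = 0 := by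
    refine le_antisymm ?_ (hl j)
    rw [← coroot'_smul_smul (word (M ++ [j]))]
    exact h.nonpos_of_not_pos hneg hwl
  have hfix : word (M ++ [j]) • l = word M • l := by
    rw [hw, mul_smul, refl_smul, h0, zero_smul, sub_zero]
  rw [hfix] at hwl ⊢
  exact ih M.length (by rw [← hn]; simp) M hwl rfl

end Words

/-! ### The sum of the positive coroots -/

section TwoRhoCheck

variable [Fintype ι]

omit h in
open scoped Classical in
variable (ϖ) in
/-- The sum of the positive coroots, as a linear form on the weight lattice. It serves as a degree
function on weights. -/
def deg : X →ₗ[ℤ] ℤ := ∑ i with Pos ϖ i, P.coroot' i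

omit h in
open scoped Classical in
lemma deg_apply (l : X) : deg ϖ l = ∑ i with Pos ϖ i, P.coroot' i l := by
  simp [deg]

omit h in
variable (P) in
/-- The sum of the absolute values of all coroots at a weight. It is invariant under the Weyl group
and at least twice `deg`, with equality exactly for dominant weights. -/
def absDeg (l : X) : ℤ := ∑ i, |P.coroot' i l|

omit h in
lemma absDeg_smul (w : P.weylGroup) (l : X) : absDeg P (w • l) = absDeg P l := by
  refine Fintype.sum_bijective _ (MulAction.bijective w⁻¹) _ _ fun i => ?_
  rw [coroot'_smul]

open scoped Classical in
lemma absDeg_eq (l : X) : absDeg P l = 2 * ∑ i with Pos ϖ i, |P.coroot' i l| := by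
  have hneg : ∑ i with ¬ Pos ϖ i, |P.coroot' i l| = ∑ i with Pos ϖ i, |P.coroot' i l| := by
    have hinv : ∀ i : ι, refl P (refl P i • i) • (refl P i • i) = i := fun i => by
      rw [refl_conj, mul_smul, mul_smul, inv_smul_smul, ← mul_smul, refl_mul_self, one_smul]
    refine Finset.sum_nbij' (fun i => refl P i • i) (fun i => refl P i • i) ?_ ?_ ?_ ?_ ?_
    · intro i hi
      simpa [h.pos_refl_self_iff] using hi
    · intro i hi
      simpa [h.pos_refl_self_iff] using hi
    · exact fun i _ => hinv i
    · exact fun i _ => hinv i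
    · intro i _
      rw [refl_smul_self, abs_neg]
  rw [absDeg, ← Finset.sum_filter_add_sum_filter_not Finset.univ (Pos ϖ), hneg]
  ring

lemma two_mul_deg_le (l : X) : 2 * deg ϖ l ≤ absDeg P l := by
  classical
  rw [h.absDeg_eq, deg_apply]
  gcongr
  exact le_abs_self _

lemma two_mul_deg_eq {l : X} (hl : IsDominant b l) : 2 * deg ϖ l = absDeg P l := by
  classical
  rw [h.absDeg_eq, deg_apply]
  congr 1
  refine Finset.sum_congr rfl fun i hi => ?_
  rw [abs_of_nonneg]
  exact Pos.nonneg h (Finset.mem_filter.mp hi).2 hl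

lemma isDominant_of_two_mul_deg_eq {l : X} (hl : 2 * deg ϖ l = absDeg P l) :
    IsDominant b l := by
  classical
  rw [h.absDeg_eq, deg_apply] at hl
  have hl' := mul_left_cancel₀ two_ne_zero hl
  rw [Finset.sum_eq_sum_iff_of_le fun i _ => le_abs_self _] at hl'
  intro j
  rw [hl' j (Finset.mem_filter.mpr ⟨Finset.mem_univ _, h.pos_simple j⟩)]
  exact abs_nonneg _

/-- Among the weights in the orbit of a dominant weight, that weight has the largest degree, and it
is the only one with that degree. -/
lemma deg_smul_lt {l : X} (hl : IsDominant b l) {w : P.weylGroup} (hw : w • l ≠ l) :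
    deg ϖ (w • l) < deg ϖ l := by
  have h1 := h.two_mul_deg_le (w • l)
  have h2 := h.two_mul_deg_eq hl
  rw [absDeg_smul, ← h2] at h1
  refine lt_of_le_of_ne (by lia) fun heq => hw ?_
  refine h.smul_eq_of_isDominant hl (h.isDominant_of_two_mul_deg_eq ?_)
  rw [absDeg_smul, heq, h2]

lemma deg_nonneg {l : X} (hl : IsDominant b l) : 0 ≤ deg ϖ l := by
  classical
  rw [deg_apply]
  exact Finset.sum_nonneg fun i hi => Pos.nonneg h (Finset.mem_filter.mp hi).2 hl

lemma deg_root_pos {i : ι} (hi : Pos ϖ i) : 0 < deg ϖ (P.root i) := by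
  have hne : refl P i • rho ϖ ≠ rho ϖ := by
    intro heq
    have := refl_smul_self (P := P) i (rho ϖ)
    rw [← coroot'_smul_smul (refl P i)] at this
    have h2 := coroot'_smul_smul (refl P i) i (rho ϖ)
    rw [refl_smul_self] at h2
    rw [heq] at h2
    rw [Pos] at hi
    lia
  have := h.deg_smul_lt h.isDominant_rho hne
  rw [refl_smul, map_sub, map_smul, smul_eq_mul] at this
  exact pos_of_mul_pos_right (by lia) hi.le

lemma deg_root_neg {i : ι} (hi : ¬ Pos ϖ i) : deg ϖ (P.root i) < 0 := by
  have := h.deg_root_pos ((h.pos_refl_self_iff i).mpr hi)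
  rw [← smul_root, refl_smul, root_coroot'_eq_pairing, pairing_same, map_sub, map_smul,
    smul_eq_mul] at this
  lia

lemma deg_root_ne_zero (i : ι) : deg ϖ (P.root i) ≠ 0 := by
  by_cases hi : Pos ϖ i
  · exact (h.deg_root_pos hi).ne'
  · exact (h.deg_root_neg hi).ne

/-- A weight that is not dominant has a simple reflection of larger degree. -/
lemma exists_deg_lt_deg_refl {l : X} (hl : ¬ IsDominant b l) :
    ∃ j : b.support, deg ϖ l < deg ϖ (refl P (j : ι) • l) := by
  simp only [IsDominant, not_forall, not_le] at hl
  obtain ⟨j, hj⟩ := hl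
  refine ⟨j, ?_⟩
  rw [refl_smul, map_sub, map_smul, smul_eq_mul]
  have := mul_neg_of_neg_of_pos hj (h.deg_root_pos (h.pos_simple j))
  lia

end TwoRhoCheck

end IsDualWeightBasis

end WeylCombinatorics

/-! ### Leading terms in group algebras -/

section LeadingTerms

open AddMonoidAlgebra

variable {X : Type*} [AddCommGroup X] (d : X →ₗ[ℤ] ℤ)

/-- The elements of the group algebra supported on weights of degree less than `n`. -/
def lowerDeg (n : ℤ) : Submodule ℂ (AddMonoidAlgebra ℂ X) where
  carrier := {F | ∀ l, n ≤ d l → F.coeff l = 0}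
  zero_mem' := by simp
  add_mem' := by
    intro F G hF hG l hl
    simp [hF l hl, hG l hl]
  smul_mem' := by
    intro c F hF l hl
    simp [hF l hl]

/-- `F` is the monomial `c e^l` plus terms of degree less than that of `l`. The coefficient `c` is
allowed to vanish. -/
def HasTop (F : AddMonoidAlgebra ℂ X) (l : X) (c : ℂ) : Prop :=
  F - single l c ∈ lowerDeg d (d l)

variable {d}

lemma single_mem_lowerDeg {n : ℤ} {l : X} (hl : d l < n) (c : ℂ) :
    single l c ∈ lowerDeg d n := by
  classical
  intro m hm
  rw [coeff_single, Finsupp.single_apply, if_neg]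
  rintro rfl
  lia

lemma lowerDeg_mono {n m : ℤ} (h : n ≤ m) : lowerDeg d n ≤ lowerDeg d m :=
  fun _ hF l hl => hF l (h.trans hl)

lemma mul_mem_lowerDeg {n m k : ℤ} (hk : n + m ≤ k + 1) {F G : AddMonoidAlgebra ℂ X}
    (hF : F ∈ lowerDeg d n) (hG : G ∈ lowerDeg d m) : F * G ∈ lowerDeg d k := by
  classical
  intro l hl
  by_contra hne
  obtain ⟨x, hx, y, hy, rfl⟩ := Finset.mem_add.mp
    (support_coeff_mul_subset F G (Finsupp.mem_support_iff.mpr hne))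
  have h1 : d x < n := by
    by_contra hlt
    exact Finsupp.mem_support_iff.mp hx (hF x (not_lt.mp hlt))
  have h2 : d y < m := by
    by_contra hlt
    exact Finsupp.mem_support_iff.mp hy (hG y (not_lt.mp hlt))
  rw [map_add] at hl
  lia

lemma HasTop.mem_lowerDeg {F : AddMonoidAlgebra ℂ X} {l : X} {c : ℂ} (h : HasTop d F l c) :
    F ∈ lowerDeg d (d l + 1) := by
  have := add_mem (lowerDeg_mono (by lia : d l ≤ d l + 1) h)
    (single_mem_lowerDeg (by lia : d l < d l + 1) c)
  simpa using this

lemma hasTop_single (l : X) (c : ℂ) : HasTop d (single l c) l c := by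
  rw [HasTop, sub_self]; exact zero_mem _

lemma hasTop_one : HasTop d (1 : AddMonoidAlgebra ℂ X) 0 1 := hasTop_single 0 1

lemma hasTop_zero (l : X) : HasTop d (0 : AddMonoidAlgebra ℂ X) l 0 := by
  rw [HasTop]; simp

lemma HasTop.add {F G : AddMonoidAlgebra ℂ X} {l : X} {a c : ℂ} (hF : HasTop d F l a)
    (hG : HasTop d G l c) : HasTop d (F + G) l (a + c) := by
  have := add_mem hF hG
  rw [HasTop, single_add]
  convert this using 1
  abel

lemma HasTop.smul {F : AddMonoidAlgebra ℂ X} {l : X} {c : ℂ} (hF : HasTop d F l c) (a : ℂ) :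
    HasTop d (a • F) l (a * c) := by
  have := Submodule.smul_mem _ a hF
  rwa [smul_sub, smul_single, smul_eq_mul] at this

lemma HasTop.add_lower {F G : AddMonoidAlgebra ℂ X} {l : X} {c : ℂ} (hF : HasTop d F l c)
    (hG : G ∈ lowerDeg d (d l)) : HasTop d (F + G) l c := by
  rw [HasTop, add_sub_right_comm]
  exact add_mem hF hG

lemma hasTop_of_mem {G : AddMonoidAlgebra ℂ X} {l : X}
    (hG : G ∈ lowerDeg d (d l)) : HasTop d G l 0 := by
  simpa using (hasTop_zero l).add_lower hG

lemma HasTop.sub {F G : AddMonoidAlgebra ℂ X} {l : X} {a c : ℂ} (hF : HasTop d F l a)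
    (hG : HasTop d G l c) : HasTop d (F - G) l (a - c) := by
  simpa [sub_eq_add_neg] using hF.add (hG.smul (-1))

lemma HasTop.sum {κ : Type*} (s : Finset κ) {F : κ → AddMonoidAlgebra ℂ X} {l : X} {c : κ → ℂ}
    (hF : ∀ k ∈ s, HasTop d (F k) l (c k)) : HasTop d (∑ k ∈ s, F k) l (∑ k ∈ s, c k) := by
  classical
  induction s using Finset.induction_on with
  | empty => simpa using hasTop_zero l
  | insert a s ha ih =>
    rw [Finset.sum_insert ha, Finset.sum_insert ha]
    exact (hF a (by simp)).add (ih fun k hk => hF k (by simp [hk]))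

lemma HasTop.mul {F G : AddMonoidAlgebra ℂ X} {l m : X} {a c : ℂ} (hF : HasTop d F l a)
    (hG : HasTop d G m c) : HasTop d (F * G) (l + m) (a * c) := by
  have e : F * G - single (l + m) (a * c) =
      (F - single l a) * G + single l a * (G - single m c) := by
    rw [mul_sub, single_mul_single]; ring
  rw [HasTop, e]
  refine add_mem (mul_mem_lowerDeg ?_ hF hG.mem_lowerDeg)
    (mul_mem_lowerDeg ?_ (hasTop_single l a).mem_lowerDeg hG)
  all_goals rw [map_add]; lia

lemma HasTop.prod {κ : Type*} (s : Finset κ) {F : κ → AddMonoidAlgebra ℂ X} {l : κ → X}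
    {c : κ → ℂ} (hF : ∀ k ∈ s, HasTop d (F k) (l k) (c k)) :
    HasTop d (∏ k ∈ s, F k) (∑ k ∈ s, l k) (∏ k ∈ s, c k) := by
  classical
  induction s using Finset.induction_on with
  | empty => simpa using hasTop_one
  | insert a s ha ih =>
    rw [Finset.prod_insert ha, Finset.sum_insert ha, Finset.prod_insert ha]
    exact (hF a (by simp)).mul (ih fun k hk => hF k (by simp [hk]))

lemma HasTop.pow {F : AddMonoidAlgebra ℂ X} {l : X} {c : ℂ} (hF : HasTop d F l c) (n : ℕ) :
    HasTop d (F ^ n) (n • l) (c ^ n) := by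
  simpa using HasTop.prod (Finset.range n) (F := fun _ => F) (fun _ _ => hF)

lemma HasTop.det {κ : Type*} [Fintype κ] [DecidableEq κ]
    {E : Matrix κ κ (AddMonoidAlgebra ℂ X)} {l : κ → X} {C : Matrix κ κ ℂ}
    (hE : ∀ i j, HasTop d (E i j) (l i) (C i j)) : HasTop d E.det (∑ i, l i) C.det := by
  rw [Matrix.det_apply, Matrix.det_apply]
  refine HasTop.sum _ fun s _ => ?_
  have h1 := HasTop.prod (d := d) Finset.univ (F := fun i => E (s i) i) (l := fun i => l (s i))
    (c := fun i => C (s i) i) fun i _ => hE _ _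
  rw [Equiv.sum_comp s l] at h1
  rcases Int.units_eq_one_or (Equiv.Perm.sign s) with hs | hs
  · simpa [hs] using h1
  · simpa [hs] using h1.smul (-1)

end LeadingTerms

/-! ### The Weyl group acting on the group algebra -/

section Action

open AddMonoidAlgebra RootPairing

variable {ι X Y : Type*} [AddCommGroup X] [AddCommGroup Y]
  {P : RootPairing ι ℤ X Y} {b : P.Base} {ϖ : b.support → X}

variable (P) in
/-- The Weyl group acts on the group algebra of the weight lattice by algebra automorphisms. -/
def weylAlgEquiv : P.weylGroup →* (AddMonoidAlgebra ℂ X ≃ₐ[ℂ] AddMonoidAlgebra ℂ X) where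
  toFun w := domCongr ℂ ℂ (DistribMulAction.toAddEquiv X w)
  map_one' := by
    ext F l
    simp [DistribMulAction.toAddEquiv]
  map_mul' v w := by
    ext F l
    simp [DistribMulAction.toAddEquiv, mul_smul]

instance weylAction : MulSemiringAction P.weylGroup (AddMonoidAlgebra ℂ X) :=
  MulSemiringAction.compHom _ (weylAlgEquiv P)

lemma weyl_smul_def (w : P.weylGroup) (F : AddMonoidAlgebra ℂ X) :
    w • F = domCongr ℂ ℂ (DistribMulAction.toAddEquiv X w) F := rfl

@[simp] lemma weyl_smul_single (w : P.weylGroup) (l : X) (c : ℂ) :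
    w • (single l c : AddMonoidAlgebra ℂ X) = single (w • l) c := by
  simp [weyl_smul_def, DistribMulAction.toAddEquiv]

lemma coeff_weyl_smul (w : P.weylGroup) (F : AddMonoidAlgebra ℂ X) (l : X) :
    (w • F).coeff (w • l) = F.coeff l := by
  simp [weyl_smul_def, DistribMulAction.toAddEquiv]

lemma weyl_smul_smul (w : P.weylGroup) (c : ℂ) (F : AddMonoidAlgebra ℂ X) :
    w • (c • F) = c • (w • F) := by
  simp [weyl_smul_def]

/-- An element of the group algebra is alternating if simple reflections change its sign. -/
def IsAlternating (b : P.Base) (F : AddMonoidAlgebra ℂ X) : Prop :=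
  ∀ j : b.support, refl P (j : ι) • F = -F

lemma IsAlternating.coeff_smul {F : AddMonoidAlgebra ℂ X} (hF : IsAlternating b F)
    (j : b.support) (l : X) : F.coeff (refl P (j : ι) • l) = - F.coeff l := by
  have := coeff_weyl_smul (refl P (j : ι)) F l
  rw [hF j] at this
  rw [← this]; simp

lemma IsAlternating.sub_smul {F G : AddMonoidAlgebra ℂ X} (hF : IsAlternating b F)
    (hG : IsAlternating b G) (c : ℂ) : IsAlternating b (F - c • G) := by
  intro j
  rw [smul_sub, weyl_smul_smul, hF j, hG j]
  simp; abel

variable [Fintype P.weylGroup]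

variable (P) in
/-- The sum of `a (w l) e^(w l)` over the Weyl group elements `w`. -/
def weylSum (a : X → ℂ) (l : X) : AddMonoidAlgebra ℂ X :=
  ∑ w : P.weylGroup, single (w • l) (a (w • l))

variable (P) in
/-- The sum of the exponentials of the Weyl group translates of a weight `l`. It is a multiple of
the sum over the orbit, by the order of the stabilizer. -/
abbrev orbitSum (l : X) : AddMonoidAlgebra ℂ X := weylSum P 1 l

variable (P) in
/-- The order of the stabilizer of a weight in the Weyl group. -/
def stabCard (l : X) : ℕ := by
  classical exact Finset.card {w : P.weylGroup | w • l = l}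

lemma stabCard_pos (l : X) : 0 < stabCard P l := by
  classical
  exact Finset.card_pos.mpr ⟨1, by simp⟩

lemma weyl_smul_weylSum (v : P.weylGroup) (a : X → ℂ) (l : X) :
    v • weylSum P a l = weylSum P (fun m => a (v⁻¹ • m)) l := by
  rw [weylSum, weylSum, Finset.smul_sum]
  refine Fintype.sum_bijective (v * ·) (Group.mulLeft_bijective v) _ _ fun w => ?_
  rw [weyl_smul_single, mul_smul, inv_smul_smul]

lemma weyl_smul_orbitSum (v : P.weylGroup) (l : X) : v • orbitSum P l = orbitSum P l :=
  weyl_smul_weylSum v 1 l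

/-- The Jacobian matrix of the orbit sums of the fundamental weights, with respect to the invariant
vector fields given by the simple coroots. -/
def jacobian (ϖ : b.support → X) : Matrix b.support b.support (AddMonoidAlgebra ℂ X) :=
  fun i j => weylSum P (fun l => (P.coroot' j l : ℂ)) (ϖ i)

open scoped Classical in
/-- The Weyl denominator `e^ρ ∏ (1 - e^(-α))`, the product over the positive roots. -/
def weylDenominator [Fintype ι] (ϖ : b.support → X) : AddMonoidAlgebra ℂ X :=
  single (IsDualWeightBasis.rho ϖ) 1 *
    ∏ i with IsDualWeightBasis.Pos ϖ i, (1 - single (-P.root i) 1)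

namespace IsDualWeightBasis

variable (h : IsDualWeightBasis b ϖ) [Fintype ι]
include h

lemma hasTop_weylSum (a : X → ℂ) {l : X} (hl : IsDominant b l) :
    HasTop (deg ϖ) (weylSum P a l) l (stabCard P l * a l) := by
  classical
  rw [weylSum, ← Finset.sum_filter_add_sum_filter_not Finset.univ (fun w => w • l = l)]
  refine HasTop.add_lower ?_ ?_
  · have : ∑ w : P.weylGroup with w • l = l, single (w • l) (a (w • l)) =
        (single l (stabCard P l * a l) : AddMonoidAlgebra ℂ X) := by
      rw [Finset.sum_congr rfl (g := fun _ => single l (a l))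
        (fun w hw => by rw [(Finset.mem_filter.mp hw).2])]
      rw [Finset.sum_const, smul_single, nsmul_eq_mul, stabCard]
    rw [this]
    exact hasTop_single _ _
  · refine Submodule.sum_mem _ fun w hw => single_mem_lowerDeg ?_ _
    exact h.deg_smul_lt hl (Finset.mem_filter.mp hw).2

lemma hasTop_orbitSum {l : X} (hl : IsDominant b l) :
    HasTop (deg ϖ) (orbitSum P l) l (stabCard P l) := by
  simpa using h.hasTop_weylSum 1 hl

open scoped Classical in
lemma hasTop_jacobian_det : HasTop (deg ϖ) (jacobian ϖ).det (rho ϖ)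
    (∏ i, (stabCard P (ϖ i) : ℂ)) := by
  classical
  have key := HasTop.det (d := deg ϖ) (E := jacobian ϖ) (l := ϖ)
    (C := Matrix.diagonal fun i => (stabCard P (ϖ i) : ℂ)) fun i j => by
    have := h.hasTop_weylSum (fun l => (P.coroot' j l : ℂ)) (h.isDominant_weight i)
    rw [h.coroot'_apply] at this
    rw [Matrix.diagonal_apply]
    change HasTop (deg ϖ) (weylSum P _ (ϖ i)) _ _
    split_ifs at this ⊢ with hij
    · simpa using! this
    · simpa using! this
  rwa [Matrix.det_diagonal] at key

omit h [Fintype ι] in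
open scoped Classical in
lemma isAlternating_jacobian_det : IsAlternating b (jacobian ϖ).det := by
  classical
  intro j
  have hsmul : refl P (j : ι) • (jacobian ϖ).det =
      ((MulSemiringAction.toRingHom _ (AddMonoidAlgebra ℂ X) (refl P (j : ι))).mapMatrix
        (jacobian ϖ)).det := by
    rw [← RingHom.map_det]; rfl
  -- A simple reflection acts on the Jacobian matrix by right multiplication with a reflection.
  let u : b.support → AddMonoidAlgebra ℂ X := Pi.single j (-1)
  let v : b.support → AddMonoidAlgebra ℂ X := fun k => ((P.coroot' k (P.root j) : ℤ) : _)
  have hE : (MulSemiringAction.toRingHom _ (AddMonoidAlgebra ℂ X) (refl P (j : ι))).mapMatrix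
      (jacobian ϖ) = jacobian ϖ * (1 + Matrix.vecMulVec u v) := by
    ext1 i k
    rw [Matrix.mul_add, mul_one, Matrix.mul_vecMulVec, Matrix.add_apply, Matrix.vecMulVec_apply]
    have h1 : (jacobian ϖ).mulVec u i = - jacobian ϖ i j := by simp [u]
    rw [h1]
    change refl P (j : ι) • weylSum P _ (ϖ i) = _
    rw [weyl_smul_weylSum, jacobian, jacobian, weylSum, weylSum, weylSum, neg_mul,
      ← sub_eq_add_neg, Finset.sum_mul, ← Finset.sum_sub_distrib]
    refine Finset.sum_congr rfl fun w _ => ?_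
    have h2 : v k = single 0 ((P.coroot' k (P.root j) : ℤ) : ℂ) := by
      simp only [v]
      rw [← map_intCast (algebraMap ℂ (AddMonoidAlgebra ℂ X))]; rfl
    rw [h2, single_mul_single, add_zero, ← single_sub, refl_inv, AlgTorus.refl_smul, map_sub,
      map_zsmul]
    simp
  rw [hsmul, hE, Matrix.det_mul, Matrix.vecMulVec_eq Unit,
    Matrix.det_one_add_replicateCol_mul_replicateRow]
  have h3 : v ⬝ᵥ u = -2 := by
    simp [u, v, dotProduct_single]
  rw [h3]; ring

omit [Fintype P.weylGroup] in
lemma hasTop_weylDenominator : HasTop (deg ϖ) (weylDenominator ϖ) (rho ϖ) 1 := by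
  classical
  have h1 : HasTop (deg ϖ) (∏ i with Pos ϖ i, (1 - single (-P.root i) 1 : AddMonoidAlgebra ℂ X))
      (∑ i with Pos ϖ i, 0) (∏ i with Pos ϖ i, 1) := by
    refine HasTop.prod _ fun i hi => ?_
    have hd := h.deg_root_pos (Finset.mem_filter.mp hi).2
    have := hasTop_one.sub (hasTop_of_mem (d := deg ϖ) (l := 0)
      (single_mem_lowerDeg (l := -P.root i) (by simpa using hd) 1))
    simpa using this
  have := (hasTop_single (d := deg ϖ) (rho ϖ) 1).mul h1
  simpa [weylDenominator] using this

omit [Fintype P.weylGroup] in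
lemma isAlternating_weylDenominator : IsAlternating b (weylDenominator ϖ) := by
  classical
  intro j
  have hj : (j : ι) ∈ Finset.univ.filter (Pos ϖ) := by simpa using h.pos_simple j
  rw [weylDenominator, smul_mul', weyl_smul_single, Finset.smul_prod',
    AlgTorus.refl_smul, h.coroot'_rho, one_smul, ← Finset.mul_prod_erase _ _ hj,
    ← Finset.mul_prod_erase _ _ hj]
  have hs : ∀ i, refl P (j : ι) • (1 - single (-P.root i) 1 : AddMonoidAlgebra ℂ X) =
      1 - single (-P.root (refl P (j : ι) • i)) 1 := by
    intro i
    rw [smul_sub, smul_one, weyl_smul_single, smul_neg, smul_root]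
  have hprod : ∏ i ∈ (Finset.univ.filter (Pos ϖ)).erase j,
      refl P (j : ι) • (1 - single (-P.root i) 1 : AddMonoidAlgebra ℂ X) =
      ∏ i ∈ (Finset.univ.filter (Pos ϖ)).erase j, (1 - single (-P.root i) 1) := by
    have hinv : ∀ i : ι, refl P (j : ι) • refl P (j : ι) • i = i := fun i => by
      rw [← mul_smul, refl_mul_self, one_smul]
    have hne : ∀ i, Pos ϖ i → refl P (j : ι) • i ≠ j := by
      intro i hi heq
      have hneg : ¬ Pos ϖ (refl P (j : ι) • (j : ι)) := by
        rw [h.pos_refl_self_iff]; simpa using h.pos_simple j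
      have hi' := hinv i
      rw [heq] at hi'
      rw [hi'] at hneg
      exact hneg hi
    have hmem : ∀ i ∈ (Finset.univ.filter (Pos ϖ)).erase j,
        refl P (j : ι) • i ∈ (Finset.univ.filter (Pos ϖ)).erase j := by
      intro i hi
      simp only [Finset.mem_erase, Finset.mem_filter, Finset.mem_univ, true_and] at hi ⊢
      exact ⟨hne i hi.2, Pos.refl_smul h hi.2 j hi.1⟩
    exact Finset.prod_nbij' (fun i => refl P (j : ι) • i) (fun i => refl P (j : ι) • i)
      hmem hmem (fun i _ => hinv i) (fun i _ => hinv i) fun i _ => hs i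
  have hself : refl P (j : ι) • (1 - single (-P.root j) 1 : AddMonoidAlgebra ℂ X) =
      1 - single (P.root j) 1 := by
    rw [hs, ← smul_root, AlgTorus.refl_smul, root_coroot'_eq_pairing, pairing_same]
    congr 2
    module
  have hfac : (single (rho ϖ - P.root j) 1 * (1 - single (P.root j) 1) : AddMonoidAlgebra ℂ X) =
      -(single (rho ϖ) 1 * (1 - single (-P.root j) 1)) := by
    rw [mul_sub, mul_sub, single_mul_single, single_mul_single]
    simp [sub_eq_add_neg]
  rw [hprod, hself, ← mul_assoc, hfac]
  ring

omit [Fintype P.weylGroup] in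
/-- An alternating element all of whose weights have degree less than that of `ρ` vanishes, because
its weights of largest degree would be strictly dominant. -/
lemma eq_zero_of_isAlternating {F : AddMonoidAlgebra ℂ X} (hF : IsAlternating b F)
    (hd : F ∈ lowerDeg (deg ϖ) (deg ϖ (rho ϖ))) : F = 0 := by
  by_contra hne
  have hs : F.coeff.support.Nonempty := by
    rw [Finsupp.support_nonempty_iff]
    simpa using hne
  obtain ⟨l, hl, hmax⟩ := Finset.exists_max_image F.coeff.support (deg ϖ) hs
  have hl0 := Finsupp.mem_support_iff.mp hl
  have hdom : IsDominant b l := by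
    by_contra hnd
    obtain ⟨j, hj⟩ := h.exists_deg_lt_deg_refl hnd
    have := hmax (refl P (j : ι) • l)
      (Finsupp.mem_support_iff.mpr (by rw [hF.coeff_smul]; simpa using hl0))
    lia
  have hsub : IsDominant b (l - rho ϖ) := by
    intro j
    have h1 := hdom j
    have h2 : P.coroot' j l ≠ 0 := by
      intro h0
      have := hF.coeff_smul j l
      rw [AlgTorus.refl_smul, h0, zero_smul, sub_zero] at this
      exact hl0 (self_eq_neg.mp this)
    rw [map_sub, h.coroot'_rho]
    lia
  have h3 := h.deg_nonneg hsub
  rw [map_sub] at h3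
  exact hl0 (hd l (by lia))

open scoped Classical in
/-- The Jacobian determinant of the orbit sums of the fundamental weights is a multiple of the Weyl
denominator. -/
theorem jacobian_det_eq : (jacobian ϖ).det =
    (∏ i, (stabCard P (ϖ i) : ℂ)) • weylDenominator ϖ := by
  rw [← sub_eq_zero]
  refine h.eq_zero_of_isAlternating
    (isAlternating_jacobian_det.sub_smul h.isAlternating_weylDenominator _) ?_
  have := h.hasTop_jacobian_det.sub (h.hasTop_weylDenominator.smul (∏ i, (stabCard P (ϖ i) : ℂ)))
  rw [HasTop] at this
  simpa using this

/-! ### Invariants of the Weyl group -/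

/-- Induction on the degree: the terms of largest degree of an invariant element, as far as their
weights are dominant, are those of a polynomial in the orbit sums, and the difference is an
invariant element of smaller degree because all its weights of largest degree are dominant. -/
lemma exists_aeval_of_mem_lowerDeg (n : ℕ) {F : AddMonoidAlgebra ℂ X}
    (hF : ∀ w : P.weylGroup, w • F = F) (hn : F ∈ lowerDeg (deg ϖ) n) :
    ∃ p : MvPolynomial b.support ℂ, MvPolynomial.aeval (fun i => orbitSum P (ϖ i)) p = F := by
  classical
  have hcoeff : ∀ {F : AddMonoidAlgebra ℂ X} (_ : ∀ w : P.weylGroup, w • F = F)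
      (w : P.weylGroup) (l : X), F.coeff (w • l) = F.coeff l := fun {F} hF w l => by
    conv_lhs => rw [← hF w]
    exact coeff_weyl_smul w F l
  -- weights of largest degree are dominant
  have hdom : ∀ {F : AddMonoidAlgebra ℂ X} (_ : ∀ w : P.weylGroup, w • F = F) (l : X)
      (_ : F.coeff l ≠ 0) (_ : F ∈ lowerDeg (deg ϖ) (deg ϖ l + 1)), IsDominant b l := by
    intro F hF l hl hd
    by_contra hnd
    obtain ⟨j, hj⟩ := h.exists_deg_lt_deg_refl hnd
    exact hl (by rw [← hcoeff hF (refl P (j : ι)) l]; exact hd _ (by lia))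
  induction n generalizing F with
  | zero =>
    refine ⟨0, ?_⟩
    rw [map_zero]
    by_contra hne
    have hs : F.coeff.support.Nonempty := by
      rw [Finsupp.support_nonempty_iff]
      simpa using Ne.symm hne
    obtain ⟨l, hl, hmax⟩ := Finset.exists_max_image F.coeff.support (deg ϖ) hs
    have hl0 := Finsupp.mem_support_iff.mp hl
    have := h.deg_nonneg (hdom hF l hl0 fun m hm => by
      by_contra hm0
      have := hmax m (Finsupp.mem_support_iff.mpr hm0)
      lia)
    exact hl0 (hn l (by simpa using this))
  | succ n ih =>
    let D : Finset X := F.coeff.support.filter fun l => deg ϖ l = n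
    have hD : ∀ l ∈ D, IsDominant b l := by
      intro l hl
      obtain ⟨h1, h2⟩ := Finset.mem_filter.mp hl
      refine hdom hF l (Finsupp.mem_support_iff.mp h1) ?_
      rw [h2]; exact_mod_cast hn
    let e : X → b.support → ℕ := fun l j => (P.coroot' j l).toNat
    let M : X → MvPolynomial b.support ℂ := fun l => ∏ j, MvPolynomial.X j ^ e l j
    let c : X → ℂ := fun l => ∏ j, (stabCard P (ϖ j) : ℂ) ^ e l j
    have hc : ∀ l, c l ≠ 0 := fun l => Finset.prod_ne_zero_iff.mpr fun j _ =>
      pow_ne_zero _ (Nat.cast_ne_zero.mpr (stabCard_pos _).ne')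
    have hM : ∀ l ∈ D, HasTop (deg ϖ)
        (MvPolynomial.aeval (fun i => orbitSum P (ϖ i)) (M l)) l (c l) := by
      intro l hl
      have h1 := HasTop.prod (d := deg ϖ) Finset.univ fun j (_ : j ∈ Finset.univ) =>
        (h.hasTop_orbitSum (h.isDominant_weight j)).pow (e l j)
      have h2 : ∑ j, e l j • ϖ j = l := by
        conv_rhs => rw [← h.sum_smul l]
        refine Finset.sum_congr rfl fun j _ => ?_
        rw [← natCast_zsmul, Int.toNat_of_nonneg (hD l hl j)]
      rw [h2] at h1
      simpa [M, c] using h1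
    let p := ∑ l ∈ D, (F.coeff l / c l) • M l
    have hinv : ∀ (q : MvPolynomial b.support ℂ) (w : P.weylGroup),
        w • MvPolynomial.aeval (fun i => orbitSum P (ϖ i)) q =
          MvPolynomial.aeval (fun i => orbitSum P (ϖ i)) q := by
      intro q w
      change ((weylAlgEquiv P w).toAlgHom.comp
        (MvPolynomial.aeval fun i => orbitSum P (ϖ i))) q = _
      congr 1
      ext1 i
      simpa using! weyl_smul_orbitSum w (ϖ i)
    have hlow : F - MvPolynomial.aeval (fun i => orbitSum P (ϖ i)) p ∈ lowerDeg (deg ϖ) n := by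
      have h1 : F - ∑ l ∈ D, single l (F.coeff l) ∈ lowerDeg (deg ϖ) n := by
        intro l hl
        rw [coeff_sub, coeff_sum, Finsupp.sub_apply, Finset.sum_apply']
        simp only [coeff_single, Finsupp.single_apply, Finset.sum_ite_eq', D,
          Finset.mem_filter, Finsupp.mem_support_iff]
        by_cases hz : F.coeff l = 0
        · simp [hz]
        · have : deg ϖ l = n := by
            by_contra hne
            exact hz (hn l (by push_cast; lia))
          rw [if_pos ⟨hz, this⟩, sub_self]
      have h2 : ∑ l ∈ D, ((F.coeff l / c l) •
          MvPolynomial.aeval (fun i => orbitSum P (ϖ i)) (M l) - single l (F.coeff l)) ∈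
          lowerDeg (deg ϖ) n := by
        refine Submodule.sum_mem _ fun l hl => ?_
        have := (hM l hl).smul (F.coeff l / c l)
        rwa [HasTop, div_mul_cancel₀ _ (hc l), (Finset.mem_filter.mp hl).2] at this
      have := sub_mem h1 h2
      rw [Finset.sum_sub_distrib] at this
      convert this using 1
      simp only [p, map_sum, map_smul]
      abel
    obtain ⟨q, hq⟩ := ih (fun w => by rw [smul_sub, hF, hinv]) hlow
    exact ⟨q + p, by rw [map_add, hq, sub_add_cancel]⟩

/-- The invariants of the Weyl group are the polynomials in the orbit sums of the fundamental
weights. -/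
theorem exists_aeval_eq {F : AddMonoidAlgebra ℂ X} (hF : ∀ w : P.weylGroup, w • F = F) :
    ∃ p : MvPolynomial b.support ℂ, MvPolynomial.aeval (fun i => orbitSum P (ϖ i)) p = F := by
  refine h.exists_aeval_of_mem_lowerDeg
    ((∑ l ∈ F.coeff.support, |deg ϖ l|).toNat + 1) hF fun l hl => ?_
  by_contra hne
  have h1 : |deg ϖ l| ≤ _ := Finset.single_le_sum (f := fun l => |deg ϖ l|)
    (fun i _ => abs_nonneg _) (Finsupp.mem_support_iff.mpr hne)
  have h2 := le_abs_self (deg ϖ l)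
  lia

end IsDualWeightBasis

end Action

/-! ### Points of the torus -/

section Points

open AddMonoidAlgebra RootPairing

/-- The evaluation of an element of the group algebra of `X` at a point of the torus with character
lattice `X`. -/
def ev {X : Type*} [AddCommGroup X] (u : AddChar X ℂ) : AddMonoidAlgebra ℂ X →ₐ[ℂ] ℂ :=
  AddMonoidAlgebra.lift ℂ ℂ X u.toMonoidHom

@[simp] lemma ev_single {X : Type*} [AddCommGroup X] (u : AddChar X ℂ) (l : X) (c : ℂ) :
    ev u (single l c) = c * u l := by
  simp [ev]

/-- The point of the torus that is the exponential of an element of its Lie algebra. -/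
def expPoint {X : Type*} [AddCommGroup X] (z : X →+ ℂ) : AddChar X ℂ where
  toFun l := Complex.exp (z l)
  map_zero_eq_one' := by simp
  map_add_eq_mul' := by simp [Complex.exp_add]

@[simp] lemma expPoint_apply {X : Type*} [AddCommGroup X] (z : X →+ ℂ) (l : X) :
    expPoint z l = Complex.exp (z l) := rfl

variable {ι X Y : Type*} [AddCommGroup X] [AddCommGroup Y]
  {P : RootPairing ι ℤ X Y} {b : P.Base} {ϖ : b.support → X}

instance weylActionPoints : MulDistribMulAction P.weylGroup (AddChar X ℂ) where
  smul w u := u.compAddMonoidHom (DistribSMul.toAddMonoidHom X w⁻¹)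
  one_smul u := by
    ext l
    change u ((1 : P.weylGroup)⁻¹ • l) = u l
    rw [inv_one, one_smul]
  mul_smul v w u := by
    ext l
    change u ((v * w)⁻¹ • l) = u (w⁻¹ • v⁻¹ • l)
    rw [mul_inv_rev, mul_smul]
  smul_mul _ _ _ := rfl
  smul_one _ := rfl

lemma smul_point_apply (w : P.weylGroup) (u : AddChar X ℂ) (l : X) : (w • u) l = u (w⁻¹ • l) := rfl

lemma smul_point_mul (w : P.weylGroup) (u v : AddChar X ℂ) : w • (u * v) = (w • u) * (w • v) := rfl

lemma ev_smul_smul (w : P.weylGroup) (u : AddChar X ℂ) (F : AddMonoidAlgebra ℂ X) :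
    ev (w • u) (w • F) = ev u F := by
  have H : (ev (w • u)).comp (weylAlgEquiv P w).toAlgHom = ev u := by
    refine AddMonoidAlgebra.algHom_ext (R := ℂ) (M := X) (fun l => ?_) (by ext)
    have h1 : ev (w • u) (w • single l (1 : ℂ)) = ev u (single l 1) := by
      rw [weyl_smul_single, ev_single, ev_single, smul_point_apply, inv_smul_smul]
    exact h1
  exact DFunLike.congr_fun H F

variable (P) in
/-- A point is central if all roots are trivial on it. -/
def IsCentralPoint (x : AddChar X ℂ) : Prop := ∀ i, x (P.root i) = 1

variable (P) in
/-- A point is regular if its stabilizer in the Weyl group is trivial. -/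
def IsRegularPoint (u : AddChar X ℂ) : Prop := ∀ w : P.weylGroup, w • u = u → w = 1

/-- The points that an element of the Weyl group multiplies by a given central point. -/
def locus (g : P.weylGroup) (x : AddChar X ℂ) : Set (AddChar X ℂ) := {u | g • u = x * u}

lemma IsCentralPoint.apply_smul {x : AddChar X ℂ} (hx : IsCentralPoint P x) (w : P.weylGroup)
    (l : X) : x (w • l) = x l := by
  have key : ∀ m ∈ AddSubgroup.closure (Set.range P.root), x m = 1 := by
    intro m hm
    induction hm using AddSubgroup.closure_induction with
    | mem y hy => obtain ⟨i, rfl⟩ := hy; exact hx i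
    | zero => simp
    | add y z _ _ h1 h2 => rw [AddChar.map_add_eq_mul, h1, h2, one_mul]
    | neg y _ h1 => rw [AddChar.map_neg_eq_inv, h1, inv_one]
  have := key _ (smul_sub_mem_closure w l)
  rw [← sub_add_cancel (w • l) l, AddChar.map_add_eq_mul, this, one_mul]

lemma IsCentralPoint.smul_eq {x : AddChar X ℂ} (hx : IsCentralPoint P x) (w : P.weylGroup) :
    w • x = x := by
  ext l
  rw [smul_point_apply, hx.apply_smul]

lemma smul_mem_locus {g : P.weylGroup} {x u : AddChar X ℂ} (hx : IsCentralPoint P x)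
    (hu : u ∈ locus g x) (w : P.weylGroup) : w • u ∈ locus (w * g * w⁻¹) x := by
  change (w * g * w⁻¹) • w • u = x * w • u
  rw [mul_smul, mul_smul, inv_smul_smul, show g • u = x * u from hu, smul_point_mul, hx.smul_eq]

lemma IsRegularPoint.smul {u : AddChar X ℂ} (hu : IsRegularPoint P u) (w : P.weylGroup) :
    IsRegularPoint P (w • u) := by
  intro v hv
  have := hu (w⁻¹ * v * w) (by rw [mul_smul, mul_smul, hv, inv_smul_smul])
  rwa [mul_assoc, inv_mul_eq_one, eq_comm, mul_eq_right] at this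

lemma refl_smul_point {i : ι} {u : AddChar X ℂ} (hu : u (P.root i) = 1) : refl P i • u = u := by
  ext l
  rw [smul_point_apply, refl_inv, refl_smul, sub_eq_add_neg, ← neg_smul, AddChar.map_add_eq_mul,
    AddChar.map_zsmul_eq_zpow, hu, one_zpow, mul_one]

lemma IsRegularPoint.apply_root_ne_one {u : AddChar X ℂ} (hu : IsRegularPoint P u) (i : ι) :
    u (P.root i) ≠ 1 := by
  intro h1
  have h2 := hu _ (refl_smul_point h1)
  have h3 := refl_smul_self (P := P) i (P.root i)
  rw [h2, one_smul, root_coroot'_eq_pairing, pairing_same] at h3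
  lia

/-! ### The differential of the quotient map -/

/-- The functionals on the weight lattice that are fixed by an element of the Weyl group. -/
def fixedSpace (g : P.weylGroup) : Submodule ℂ (X →+ ℂ) where
  carrier := {z | ∀ l, z (g • l) = z l}
  zero_mem' := by simp
  add_mem' := by
    intro y z hy hz l
    simp [hy l, hz l]
  smul_mem' := by
    intro c z hz l
    simp [hz l]

lemma mul_expPoint_mem_locus {g : P.weylGroup} {x u : AddChar X ℂ} (hu : u ∈ locus g x)
    {z : X →+ ℂ} (hz : z ∈ fixedSpace g) : u * expPoint z ∈ locus g x := by
  change g • (u * expPoint z) = x * (u * expPoint z)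
  rw [smul_point_mul, show g • u = x * u from hu, mul_assoc]
  congr 2
  ext l
  rw [smul_point_apply, expPoint_apply, expPoint_apply, ← hz (g⁻¹ • l), smul_inv_smul]

variable [Fintype P.weylGroup]

variable (P) in
/-- The differential at the point `u`, in the direction of a functional `z`, of the orbit sum of
the weight `l`. -/
def diffOrbitSum (u : AddChar X ℂ) (l : X) : (X →+ ℂ) →ₗ[ℂ] ℂ where
  toFun z := ∑ w : P.weylGroup, u (w • l) * z (w • l)
  map_add' y z := by simp [mul_add, Finset.sum_add_distrib]
  map_smul' c z := by
    simp only [AddMonoidHom.smul_apply, smul_eq_mul, RingHom.id_apply, Finset.mul_sum]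
    exact Finset.sum_congr rfl fun w _ => by ring

/-- The differential at `u` of the map to affine space given by the orbit sums of the fundamental
weights. -/
def diffQuotient (ϖ : b.support → X) (u : AddChar X ℂ) : (X →+ ℂ) →ₗ[ℂ] (b.support → ℂ) :=
  LinearMap.pi fun i => diffOrbitSum P u (ϖ i)

lemma diffOrbitSum_apply (u : AddChar X ℂ) (l : X) (z : X →+ ℂ) :
    diffOrbitSum P u l z = ∑ w : P.weylGroup, u (w • l) * z (w • l) := rfl

lemma ev_orbitSum (u : AddChar X ℂ) (l : X) :
    ev u (orbitSum P l) = ∑ w : P.weylGroup, u (w • l) := by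
  simp [weylSum]

/-- Multiplication by a central point acts diagonally on the orbit sums. -/
lemma ev_mul_orbitSum {x : AddChar X ℂ} (hx : IsCentralPoint P x) (u : AddChar X ℂ) (l : X) :
    ev (x * u) (orbitSum P l) = x l * ev u (orbitSum P l) := by
  simp [ev_orbitSum, hx.apply_smul, Finset.mul_sum]

lemma ev_smul_orbitSum (g : P.weylGroup) (u : AddChar X ℂ) (l : X) :
    ev (g • u) (orbitSum P l) = ev u (orbitSum P l) := by
  conv_lhs => rw [← weyl_smul_orbitSum g]
  exact ev_smul_smul g u _

lemma diffOrbitSum_comp {g : P.weylGroup} {x u : AddChar X ℂ} (hx : IsCentralPoint P x)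
    (hu : u ∈ locus g x) (l : X) (z : X →+ ℂ) :
    diffOrbitSum P u l (z.comp (DistribSMul.toAddMonoidHom X g)) =
      x l * diffOrbitSum P u l z := by
  rw [diffOrbitSum_apply, diffOrbitSum_apply, Finset.mul_sum]
  refine Fintype.sum_bijective (g * ·) (Group.mulLeft_bijective g) _ _ fun w => ?_
  have h1 : (g • u) (g • w • l) = u (w • l) := by rw [smul_point_apply, inv_smul_smul]
  rw [show g • u = x * u from hu, AddChar.mul_apply, hx.apply_smul, hx.apply_smul] at h1
  rw [mul_smul, ← h1]
  simp; ring

namespace IsDualWeightBasis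

variable (h : IsDualWeightBasis b ϖ) [Fintype ι]
include h

omit [Fintype ι] [Fintype P.weylGroup] in
lemma addMonoidHom_apply (z : X →+ ℂ) (l : X) :
    z l = ∑ j : b.support, (P.coroot' j l : ℂ) * z (ϖ j) := by
  conv_lhs => rw [← h.sum_smul l]
  simp [map_sum]

omit [Fintype ι] in
lemma diffQuotient_eq (u : AddChar X ℂ) (z : X →+ ℂ) :
    diffQuotient ϖ u z = ((jacobian ϖ).map (ev u)).mulVec fun j => z (ϖ j) := by
  ext i
  change diffOrbitSum P u (ϖ i) z = ∑ j, ev u (weylSum P _ (ϖ i)) * z (ϖ j)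
  simp only [diffOrbitSum_apply, weylSum, map_sum, ev_single, Finset.sum_mul]
  rw [Finset.sum_comm]
  refine Finset.sum_congr rfl fun w _ => ?_
  rw [h.addMonoidHom_apply z, Finset.mul_sum]
  exact Finset.sum_congr rfl fun j _ => by ring

open scoped Classical in
lemma ev_jacobian_det_ne_zero {u : AddChar X ℂ} (hu : ∀ i, u (P.root i) ≠ 1) :
    ((jacobian ϖ).map (ev u)).det ≠ 0 := by
  have h1 := congrArg (ev u) h.jacobian_det_eq
  rw [AlgHom.map_det, map_smul, weylDenominator, map_mul, map_prod] at h1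
  change ((ev u).mapMatrix (jacobian ϖ)).det ≠ 0
  refine h1.trans_ne (smul_ne_zero ?_ (mul_ne_zero ?_ ?_))
  · exact Finset.prod_ne_zero_iff.mpr fun j _ => Nat.cast_ne_zero.mpr (stabCard_pos _).ne'
  · rw [ev_single, one_mul]
    exact (u.val_isUnit _).ne_zero
  · refine Finset.prod_ne_zero_iff.mpr fun i _ => ?_
    rw [map_sub, map_one, ev_single, one_mul, AddChar.map_neg_eq_inv, sub_ne_zero]
    intro h3
    exact hu i (inv_eq_one.mp h3.symm)

omit h in
omit [Fintype ι] [Fintype P.weylGroup] in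
lemma addMonoidHom_ext (h : IsDualWeightBasis b ϖ) {y z : X →+ ℂ} (H : ∀ j, y (ϖ j) = z (ϖ j)) :
    y = z := by
  ext l
  rw [h.addMonoidHom_apply y, h.addMonoidHom_apply z]
  simp only [H]

/-- The quotient map is étale at the points where no root is trivial. -/
lemma diffQuotient_bijective {u : AddChar X ℂ} (hu : ∀ i, u (P.root i) ≠ 1) :
    Function.Bijective (diffQuotient ϖ u) := by
  classical
  have hdet : IsUnit ((jacobian ϖ).map (ev u)) := by
    rw [Matrix.isUnit_iff_isUnit_det, isUnit_iff_ne_zero]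
    convert h.ev_jacobian_det_ne_zero hu
  constructor
  · intro y z hyz
    rw [h.diffQuotient_eq, h.diffQuotient_eq] at hyz
    have := Matrix.mulVec_injective_of_isUnit hdet hyz
    exact h.addMonoidHom_ext fun j => congrFun this j
  · intro c
    obtain ⟨a, ha⟩ := Matrix.mulVec_surjective_iff_isUnit.mpr hdet c
    refine ⟨∑ j : b.support, AddMonoidHom.mk' (fun l => (P.coroot' j l : ℂ) * a j)
      (fun l m => by rw [map_add]; push_cast; ring), ?_⟩
    rw [h.diffQuotient_eq, ← ha]
    congr 1
    ext i
    simp only [AddMonoidHom.finsetSum_apply, AddMonoidHom.mk'_apply, h.coroot'_apply]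
    simp

/-- A point on which no root is trivial has trivial stabilizer in the Weyl group, since the quotient
map is étale there. -/
lemma isRegularPoint_of_forall_ne {u : AddChar X ℂ} (hu : ∀ i, u (P.root i) ≠ 1) :
    IsRegularPoint P u := by
  intro w hw
  refine eq_one_of_forall_smul fun l => h.ext_coroot' fun j => ?_
  let z : X →+ ℂ := (Int.castAddHom ℂ).comp (P.coroot' j).toAddMonoidHom
  have h1 : z.comp (DistribSMul.toAddMonoidHom X w) = z := by
    refine (h.diffQuotient_bijective hu).1 (funext fun i => ?_)
    have := diffOrbitSum_comp (P := P) (x := 1) (fun i => rfl)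
      (show u ∈ locus w 1 by change w • u = 1 * u; rw [hw, one_mul]) (ϖ i) z
    rwa [AddChar.one_apply, one_mul] at this
  have h2 : ((P.coroot' j (w • l) : ℤ) : ℂ) = (P.coroot' j l : ℤ) := DFunLike.congr_fun h1 l
  exact_mod_cast h2

omit h [Fintype P.weylGroup] [Fintype ι] in
/-- The vectors whose coordinates vanish at the fundamental weights that are nontrivial on `x`. -/
def _root_.AlgTorus.coordSpace (ϖ : b.support → X) (x : AddChar X ℂ) :
    Submodule ℂ (b.support → ℂ) where
  carrier := {c | ∀ i, x (ϖ i) ≠ 1 → c i = 0}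
  zero_mem' := by simp
  add_mem' := by
    intro c d hc hd i hi
    simp [hc i hi, hd i hi]
  smul_mem' := by
    intro a c hc i hi
    simp [hc i hi]

lemma mem_fixedSpace_iff {g : P.weylGroup} {x u : AddChar X ℂ} (hx : IsCentralPoint P x)
    (hu : u ∈ locus g x) (hreg : IsRegularPoint P u) (z : X →+ ℂ) :
    z ∈ fixedSpace g ↔ diffQuotient ϖ u z ∈ coordSpace ϖ x := by
  have h1 : z ∈ fixedSpace g ↔ z.comp (DistribSMul.toAddMonoidHom X g) = z := by
    rw [DFunLike.ext_iff]; rfl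
  rw [h1, ← (h.diffQuotient_bijective hreg.apply_root_ne_one).1.eq_iff, funext_iff]
  refine forall_congr' fun i => ?_
  change diffOrbitSum P u (ϖ i) _ = diffOrbitSum P u (ϖ i) z ↔
    (x (ϖ i) ≠ 1 → diffOrbitSum P u (ϖ i) z = 0)
  rw [diffOrbitSum_comp hx hu, mul_left_eq_self₀]
  tauto

/-- If the locus of `g` contains a regular point then the dimension of the space fixed by `g` is
determined by `x`: the eigenvalues of `g` are the values of the fundamental weights at `x`. -/
lemma finrank_fixedSpace {g : P.weylGroup} {x u : AddChar X ℂ} (hx : IsCentralPoint P x)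
    (hu : u ∈ locus g x) (hreg : IsRegularPoint P u) :
    Module.finrank ℂ (fixedSpace g) = Module.finrank ℂ (coordSpace ϖ x) := by
  let e := LinearEquiv.ofBijective _ (h.diffQuotient_bijective hreg.apply_root_ne_one)
  have h2 : (fixedSpace g).map (e : (X →+ ℂ) →ₗ[ℂ] _) = coordSpace ϖ x := by
    ext c
    rw [Submodule.mem_map_equiv, h.mem_fixedSpace_iff hx hu hreg]
    change e (e.symm c) ∈ _ ↔ _
    rw [e.apply_symm_apply]
  rw [← h2]
  exact (e.submoduleMap _).finrank_eq

end IsDualWeightBasis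

end Points

/-! ### Krull dimension and integral extensions -/

section Integral

variable {R S : Type*} [CommRing R] [CommRing S] (f : R →+* S)

lemma ringKrullDim_le_of_ringHom_isIntegral (hf : f.IsIntegral) :
    ringKrullDim S ≤ ringKrullDim R := by
  algebraize [f]
  refine Order.krullDim_le_of_strictMono (PrimeSpectrum.comap f) fun p q hpq => ?_
  exact Ideal.IsIntegral.comap_lt_comap (R := R) (A := S) hpq

lemma ringKrullDim_eq_of_ringHom_isIntegral (hf : f.IsIntegral) (hinj : Function.Injective f) :
    ringKrullDim S = ringKrullDim R := by
  refine le_antisymm (ringKrullDim_le_of_ringHom_isIntegral f hf) ?_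
  algebraize [f]
  have : FaithfulSMul R S := (faithfulSMul_iff_algebraMap_injective R S).mpr hinj
  refine iSup_le fun l => ?_
  obtain ⟨Q, hQ, hQ'⟩ := Ideal.nonempty_primesOver (S := S) (RelSeries.head l).asIdeal
  obtain ⟨L, hL, -⟩ := Ideal.exists_ltSeries_of_hasGoingUp l Q
  rw [← hL]
  exact Order.LTSeries.length_le_krullDim L

/-- If the integral map is not injective then it factors over the quotient of the domain by a
nonzero element, which has smaller dimension. -/
lemma ringKrullDim_lt_of_ringHom_isIntegral [IsDomain R] (hf : f.IsIntegral)
    (hinj : ¬ Function.Injective f) : ringKrullDim S + 1 ≤ ringKrullDim R := by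
  rw [injective_iff_map_eq_zero] at hinj
  push Not at hinj
  obtain ⟨r, hr, hr0⟩ := hinj
  refine le_trans ?_ (ringKrullDim_quotient_succ_le_of_nonZeroDivisor
    (mem_nonZeroDivisors_of_ne_zero hr0))
  gcongr
  let k : R ⧸ Ideal.span {r} →+* S := Ideal.Quotient.lift _ f fun a ha => by
    obtain ⟨c, rfl⟩ := Ideal.mem_span_singleton'.mp ha
    rw [map_mul, hr, mul_zero]
  refine ringKrullDim_le_of_ringHom_isIntegral k (RingHom.IsIntegral.tower_top
    (Ideal.Quotient.mk _) k ?_)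
  rwa [show k.comp (Ideal.Quotient.mk _) = f from RingHom.ext fun a => rfl]

end Integral

/-! ### The quotient map to affine space -/

section Quotient

open AddMonoidAlgebra RootPairing

/-- The ideal of the functions on the torus that vanish on a set of points. -/
def vanishingIdeal {X : Type*} [AddCommGroup X] (S : Set (AddChar X ℂ)) :
    Ideal (AddMonoidAlgebra ℂ X) :=
  ⨅ u ∈ S, RingHom.ker (ev u)

lemma mem_vanishingIdeal {X : Type*} [AddCommGroup X] {S : Set (AddChar X ℂ)}
    {F : AddMonoidAlgebra ℂ X} : F ∈ vanishingIdeal S ↔ ∀ u ∈ S, ev u F = 0 := by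
  simp [vanishingIdeal]

lemma ev_aeval {X σ : Type*} [AddCommGroup X] (u : AddChar X ℂ) (m : σ → AddMonoidAlgebra ℂ X)
    (p : MvPolynomial σ ℂ) :
    ev u (MvPolynomial.aeval m p) = MvPolynomial.eval (fun i => ev u (m i)) p := by
  change (ev u).comp (MvPolynomial.aeval _) p = MvPolynomial.aeval _ p
  rw [MvPolynomial.comp_aeval]

/-- Every algebra homomorphism from the group algebra to `ℂ` is the evaluation at a point. -/
lemma exists_ev_eq {X : Type*} [AddCommGroup X] (θ : AddMonoidAlgebra ℂ X →ₐ[ℂ] ℂ) :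
    ∃ u : AddChar X ℂ, ev u = θ := by
  refine ⟨AddChar.toMonoidHomEquiv.symm ((AddMonoidAlgebra.lift ℂ ℂ X).symm θ), ?_⟩
  rw [ev]
  exact (AddMonoidAlgebra.lift ℂ ℂ X).apply_symm_apply θ

variable {ι X Y : Type*} [AddCommGroup X] [AddCommGroup Y]
  {P : RootPairing ι ℤ X Y} {b : P.Base} {ϖ : b.support → X}

/-- The points at which the functions vanishing on the locus of `g` vanish lie in that locus. -/
lemma mem_locus_of_vanishing {g : P.weylGroup} {x u : AddChar X ℂ}
    (hu : ∀ F ∈ vanishingIdeal (locus g x), ev u F = 0) : u ∈ locus g x := by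
  change g • u = x * u
  ext l
  have := hu (single (g⁻¹ • l) 1 - single l (x l)) (mem_vanishingIdeal.mpr fun v hv => by
    have h1 : (g • v) l = (x * v) l := by rw [show g • v = x * v from hv]
    rw [map_sub, ev_single, ev_single, one_mul, sub_eq_zero, ← smul_point_apply, h1,
      AddChar.mul_apply])
  rwa [map_sub, ev_single, ev_single, one_mul, sub_eq_zero, ← smul_point_apply] at this

namespace IsDualWeightBasis

variable (h : IsDualWeightBasis b ϖ) [Fintype ι] [Fintype P.weylGroup]
include h

omit h [Fintype ι] in
lemma weyl_smul_aeval_orbitSum (w : P.weylGroup) (p : MvPolynomial b.support ℂ) :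
    w • MvPolynomial.aeval (fun i => orbitSum P (ϖ i)) p =
      MvPolynomial.aeval (fun i => orbitSum P (ϖ i)) p := by
  change ((weylAlgEquiv P w).toAlgHom.comp
    (MvPolynomial.aeval fun i => orbitSum P (ϖ i))) p = _
  congr 1
  ext1 i
  simpa using! weyl_smul_orbitSum w (ϖ i)

/-- The group algebra is integral over its Weyl group invariants, which are the polynomials in the
orbit sums. -/
lemma aeval_orbitSum_isIntegral :
    (MvPolynomial.aeval (R := ℂ) fun i => orbitSum P (ϖ i)).toRingHom.IsIntegral := by
  algebraize [(MvPolynomial.aeval (R := ℂ) fun i => orbitSum P (ϖ i)).toRingHom]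
  have : Algebra.IsInvariant (MvPolynomial b.support ℂ) (AddMonoidAlgebra ℂ X) P.weylGroup :=
    ⟨fun F hF => h.exists_aeval_eq hF⟩
  exact (Algebra.IsInvariant.isIntegral (MvPolynomial b.support ℂ) (AddMonoidAlgebra ℂ X)
    P.weylGroup).isIntegral

/-- The quotient map separates the orbits of the Weyl group. -/
lemma exists_smul_eq_of_ev_orbitSum_eq {u u' : AddChar X ℂ}
    (H : ∀ i, ev u (orbitSum P (ϖ i)) = ev u' (orbitSum P (ϖ i))) :
    ∃ w : P.weylGroup, u' = w • u := by
  algebraize [(MvPolynomial.aeval (R := ℂ) fun i => orbitSum P (ϖ i)).toRingHom]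
  have : Algebra.IsInvariant (MvPolynomial b.support ℂ) (AddMonoidAlgebra ℂ X) P.weylGroup :=
    ⟨fun F hF => h.exists_aeval_eq hF⟩
  have : SMulCommClass P.weylGroup (MvPolynomial b.support ℂ) (AddMonoidAlgebra ℂ X) := by
    refine ⟨fun w p F => ?_⟩
    rw [Algebra.smul_def, Algebra.smul_def, smul_mul']
    congr 1
    exact weyl_smul_aeval_orbitSum w p
  have h1 : (RingHom.ker (ev u)).under (MvPolynomial b.support ℂ) =
      (RingHom.ker (ev u')).under (MvPolynomial b.support ℂ) := by
    ext p
    change ev u (MvPolynomial.aeval _ p) = 0 ↔ ev u' (MvPolynomial.aeval _ p) = 0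
    rw [ev_aeval, ev_aeval]
    simp only [H]
  have p1 : (RingHom.ker (ev u)).IsPrime := RingHom.ker_isPrime _
  have p2 : (RingHom.ker (ev u')).IsPrime := RingHom.ker_isPrime _
  obtain ⟨w, hw⟩ := Algebra.IsInvariant.exists_smul_of_under_eq (MvPolynomial b.support ℂ)
    (AddMonoidAlgebra ℂ X) P.weylGroup _ _ h1
  refine ⟨w, ?_⟩
  ext l
  have h2 : single l 1 - single 0 (u' l) ∈ RingHom.ker (ev u') := by
    simp
  rw [hw, Ideal.mem_pointwise_smul_iff_inv_smul_mem, smul_sub, weyl_smul_single,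
    weyl_smul_single, smul_zero, RingHom.mem_ker] at h2
  rw [map_sub, ev_single, ev_single, one_mul, AddChar.map_zero_eq_one, mul_one, sub_eq_zero] at h2
  rw [smul_point_apply, h2]

/-- The map from a polynomial ring to the coordinate ring of the locus of `g` that is given by the
orbit sums of the fundamental weights that are trivial on `x`. The other orbit sums vanish on the
locus. -/
def quotientMap (ϖ : b.support → X) (g : P.weylGroup) (x : AddChar X ℂ) :
    MvPolynomial {i // x (ϖ i) = 1} ℂ →ₐ[ℂ] AddMonoidAlgebra ℂ X ⧸ vanishingIdeal (locus g x) :=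
  MvPolynomial.aeval fun i => Ideal.Quotient.mk _ (orbitSum P (ϖ i))

omit h [Fintype ι] in
lemma ev_orbitSum_eq_zero {g : P.weylGroup} {x u : AddChar X ℂ} (hx : IsCentralPoint P x)
    (hu : u ∈ locus g x) {l : X} (hl : x l ≠ 1) : ev u (orbitSum P l) = 0 := by
  have h1 := ev_smul_orbitSum g u l
  rw [show g • u = x * u from hu, ev_mul_orbitSum hx, mul_left_eq_self₀] at h1
  exact h1.resolve_left hl

lemma quotientMap_isIntegral {g : P.weylGroup} {x : AddChar X ℂ} (hx : IsCentralPoint P x) :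
    (quotientMap ϖ g x).toRingHom.IsIntegral := by
  classical
  let ψ : MvPolynomial b.support ℂ →ₐ[ℂ] MvPolynomial {i // x (ϖ i) = 1} ℂ :=
    MvPolynomial.aeval fun i => if hi : x (ϖ i) = 1 then MvPolynomial.X ⟨i, hi⟩ else 0
  refine RingHom.IsIntegral.tower_top ψ.toRingHom _ ?_
  have h1 : (quotientMap ϖ g x).comp ψ = (Ideal.Quotient.mkₐ ℂ (vanishingIdeal (locus g x))).comp
      (MvPolynomial.aeval fun i => orbitSum P (ϖ i)) := by
    ext1 i
    simp only [AlgHom.comp_apply, ψ, MvPolynomial.aeval_X]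
    split_ifs with hi
    · simp [quotientMap]
    · rw [map_zero, eq_comm]
      exact Ideal.Quotient.eq_zero_iff_mem.mpr
        (mem_vanishingIdeal.mpr fun u hu => ev_orbitSum_eq_zero hx hu hi)
  change ((quotientMap ϖ g x).comp ψ).toRingHom.IsIntegral
  rw [h1]
  exact RingHom.IsIntegral.trans _ _ h.aeval_orbitSum_isIntegral
    (RingHom.isIntegral_of_surjective _ Ideal.Quotient.mk_surjective)

/-- If the orbit sums are algebraically independent on the locus of `g` then the locus is mapped
onto the whole of the affine space on which these orbit sums are coordinates. -/
lemma exists_mem_locus_of_injective {g : P.weylGroup} {x : AddChar X ℂ} (hx : IsCentralPoint P x)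
    (hinj : Function.Injective (quotientMap ϖ g x)) (c : b.support → ℂ) :
    ∃ u ∈ locus g x, ∀ i, x (ϖ i) = 1 → ev u (orbitSum P (ϖ i)) = c i := by
  have hint := h.quotientMap_isIntegral (g := g) hx
  let f := (quotientMap ϖ g x).toRingHom
  let ε : MvPolynomial {i // x (ϖ i) = 1} ℂ →+* ℂ := MvPolynomial.eval fun i => c i
  have hε : (RingHom.ker ε).IsMaximal :=
    RingHom.ker_isMaximal_of_surjective _ fun a => ⟨MvPolynomial.C a, MvPolynomial.eval_C _⟩
  obtain ⟨Q, hQ, hQε⟩ : ∃ Q : Ideal (AddMonoidAlgebra ℂ X ⧸ vanishingIdeal (locus g x)),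
      Q.IsMaximal ∧ Q.comap f = RingHom.ker ε := by
    algebraize [f]
    have : Algebra.IsIntegral (MvPolynomial {i // x (ϖ i) = 1} ℂ)
      (AddMonoidAlgebra ℂ X ⧸ vanishingIdeal (locus g x)) := ⟨hint⟩
    refine Ideal.exists_ideal_over_maximal_of_isIntegral (RingHom.ker ε) ?_
    have h0 : RingHom.ker f = ⊥ := (RingHom.injective_iff_ker_eq_bot f).mp hinj
    exact h0.le.trans bot_le
  let K := (AddMonoidAlgebra ℂ X ⧸ vanishingIdeal (locus g x)) ⧸ Q
  let _ : Field K := Ideal.Quotient.field Q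
  -- By integrality the residue field is algebraic over `ℂ`, hence equal to it.
  have h1 : (algebraMap ℂ K).comp ε = (Ideal.Quotient.mk Q).comp f := by
    refine MvPolynomial.ringHom_ext (fun a => ?_) fun i => ?_
    · simp only [RingHom.comp_apply, ε, MvPolynomial.eval_C]
      change _ = Ideal.Quotient.mk Q (quotientMap ϖ g x (algebraMap _ _ a))
      rw [AlgHom.commutes]
      rfl
    · have h2 : MvPolynomial.X i - MvPolynomial.C (c i) ∈ Q.comap f := by
        rw [hQε, RingHom.mem_ker]
        simp [ε]
      rw [Ideal.mem_comap, map_sub, ← Ideal.Quotient.mk_eq_mk_iff_sub_mem] at h2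
      simp only [RingHom.comp_apply, ε, MvPolynomial.eval_X]
      rw [h2]
      change _ = Ideal.Quotient.mk Q (quotientMap ϖ g x (algebraMap _ _ (c i)))
      rw [AlgHom.commutes]
      rfl
  have h3 : (algebraMap ℂ K).IsIntegral := by
    refine RingHom.IsIntegral.tower_top ε _ ?_
    rw [h1]
    exact RingHom.IsIntegral.trans _ _ hint
      (RingHom.isIntegral_of_surjective _ Ideal.Quotient.mk_surjective)
  have : Algebra.IsIntegral ℂ K := ⟨h3⟩
  have h4 := IsAlgClosed.algebraMap_bijective_of_isIntegral (k := ℂ) (K := K)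
  let e : ℂ ≃ₐ[ℂ] K := AlgEquiv.ofBijective (Algebra.ofId ℂ K) h4
  obtain ⟨u, hu⟩ := exists_ev_eq ((e.symm : K →ₐ[ℂ] ℂ).comp
    ((Ideal.Quotient.mkₐ ℂ Q).comp (Ideal.Quotient.mkₐ ℂ (vanishingIdeal (locus g x)))))
  refine ⟨u, mem_locus_of_vanishing fun F hF => ?_, fun i hi => ?_⟩
  · rw [hu]
    simp only [AlgHom.comp_apply, Ideal.Quotient.mkₐ_eq_mk]
    rw [Ideal.Quotient.eq_zero_iff_mem.mpr hF, map_zero, map_zero]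
  · rw [hu]
    have h5 := DFunLike.congr_fun h1 (MvPolynomial.X ⟨i, hi⟩)
    simp only [RingHom.comp_apply, ε, MvPolynomial.eval_X] at h5
    change e.symm (Ideal.Quotient.mk Q (Ideal.Quotient.mk _ _)) = _
    rw [AlgEquiv.symm_apply_eq]
    change _ = algebraMap ℂ K (c i)
    rw [h5]
    simp [f, quotientMap]

end IsDualWeightBasis

end Quotient

/-! ### Dimension of a locus -/

section Dimension

open AddMonoidAlgebra RootPairing

variable {ι X Y : Type*} [AddCommGroup X] [AddCommGroup Y]
  {P : RootPairing ι ℤ X Y} {b : P.Base} {ϖ : b.support → X}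

/-- The Krull dimension of the coordinate ring of the locus of `g`. -/
def locusDim (g : P.weylGroup) (x : AddChar X ℂ) : WithBot ℕ∞ :=
  ringKrullDim (AddMonoidAlgebra ℂ X ⧸ vanishingIdeal (locus g x))

namespace IsDualWeightBasis

variable (h : IsDualWeightBasis b ϖ) [Fintype ι] [Fintype P.weylGroup]
include h

/-- If the locus of `g` contains a regular point then the orbit sums of the fundamental weights
that are trivial on `x` are algebraically independent on the locus: they are local coordinates of
the locus at the regular point. -/
lemma quotientMap_injective {g : P.weylGroup} {x u : AddChar X ℂ} (hx : IsCentralPoint P x)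
    (hu : u ∈ locus g x) (hreg : IsRegularPoint P u) :
    Function.Injective (quotientMap ϖ g x) := by
  classical
  rw [injective_iff_map_eq_zero]
  intro p hp
  let κ := {i // x (ϖ i) = 1}
  let e := LinearEquiv.ofBijective _ (h.diffQuotient_bijective hreg.apply_root_ne_one)
  -- The extension by zero, and the direction in which the orbit sums have the given derivatives.
  let ext : (κ → ℂ) →ₗ[ℂ] (b.support → ℂ) :=
    LinearMap.pi fun i => if hi : x (ϖ i) = 1 then LinearMap.proj ⟨i, hi⟩ else 0
  let z : (κ → ℂ) →ₗ[ℂ] (X →+ ℂ) := e.symm.toLinearMap ∘ₗ ext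
  have hext : ∀ c (i : κ), ext c i = c i := by
    intro c i
    simp [ext, i.2]
  have hze : ∀ c, diffQuotient ϖ u (z c) = ext c := fun c => e.apply_symm_apply (ext c)
  have hz : ∀ c, u * expPoint (z c) ∈ locus g x := by
    intro c
    refine mul_expPoint_mem_locus hu ?_
    rw [h.mem_fixedSpace_iff hx hu hreg, hze]
    intro i hi
    simp [ext, hi]
  let f : (κ → ℂ) → (κ → ℂ) := fun c i => ev (u * expPoint (z c)) (orbitSum P (ϖ i))
  have hp0 : ∀ c, MvPolynomial.eval (f c) p = 0 := by
    intro c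
    let θ : (AddMonoidAlgebra ℂ X ⧸ vanishingIdeal (locus g x)) →ₐ[ℂ] ℂ :=
      Ideal.Quotient.liftₐ _ (ev (u * expPoint (z c)))
        fun F hF => mem_vanishingIdeal.mp hF _ (hz c)
    have h1 : (θ.comp (quotientMap ϖ g x)) p = 0 := by
      rw [AlgHom.comp_apply, hp, map_zero]
    rw [quotientMap, MvPolynomial.comp_aeval] at h1
    exact h1
  let zl : P.weylGroup → κ → (κ → ℂ) →L[ℂ] ℂ := fun w i => LinearMap.toContinuousLinearMap
    { toFun := fun c => z c (w • ϖ i)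
      map_add' := fun c d => by rw [map_add]; rfl
      map_smul' := fun a c => by rw [z.map_smul]; rfl }
  have hfd : HasStrictFDerivAt f (ContinuousLinearMap.id ℂ (κ → ℂ)) 0 := by
    rw [hasStrictFDerivAt_pi']
    intro i
    have hfi : (fun c => f c i) = fun c => ∑ w : P.weylGroup,
        u (w • ϖ i) * Complex.exp (zl w i c) := by
      funext c
      simp only [f, ev_orbitSum, AddChar.mul_apply]
      rfl
    rw [hfi]
    have h1 : HasStrictFDerivAt (fun c => ∑ w : P.weylGroup,
        u (w • ϖ i) * Complex.exp (zl w i c)) (∑ w : P.weylGroup, u (w • ϖ i) •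
          (Complex.exp (zl w i 0) • zl w i)) 0 :=
      HasStrictFDerivAt.fun_sum fun w _ => ((zl w i).hasStrictFDerivAt.cexp).const_mul _
    refine h1.congr_fderiv (ContinuousLinearMap.ext fun c => ?_)
    have h2 : ∑ w : P.weylGroup, u (w • ϖ i) * z c (w • ϖ i) = c i := by
      rw [← hext c i, ← hze]
      rfl
    simpa [sum_apply, zl] using h2
  -- By the inverse function theorem `f` takes all values in some ball, so `p` vanishes on it.
  have hmap := hfd.map_nhds_eq_of_equiv (f' := ContinuousLinearEquiv.refl ℂ _)
  have hmem : Set.range f ∈ nhds (f 0) := by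
    rw [← hmap]
    exact Filter.mem_map.mpr (Filter.Eventually.of_forall fun c => ⟨c, rfl⟩)
  obtain ⟨ε, hε, hball⟩ := Metric.mem_nhds_iff.mp hmem
  refine MvPolynomial.funext_set (fun i => Metric.ball (f 0 i) ε) (fun i => ?_) fun y hy => ?_
  · exact infinite_of_mem_nhds (f 0 i) (Metric.ball_mem_nhds _ hε)
  · rw [map_zero]
    rw [← ball_pi _ hε] at hy
    obtain ⟨c, rfl⟩ := hball hy
    exact hp0 c

omit h [Fintype ι] [Fintype P.weylGroup] in
lemma ringKrullDim_mvPolynomial [Finite b.support] (x : AddChar X ℂ) :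
    ringKrullDim (MvPolynomial {i // x (ϖ i) = 1} ℂ) =
      ({i | x (ϖ i) = 1} : Set b.support).ncard := by
  rw [MvPolynomial.ringKrullDim_of_isNoetherianRing, ringKrullDim_eq_zero_of_field, zero_add]
  rfl

/-- On a locus that contains a regular point, the quotient map is finite and dominant. -/
lemma locusDim_eq {g : P.weylGroup} {x u : AddChar X ℂ} (hx : IsCentralPoint P x)
    (hu : u ∈ locus g x) (hreg : IsRegularPoint P u) :
    locusDim g x = ({i | x (ϖ i) = 1} : Set b.support).ncard := by
  rw [← ringKrullDim_mvPolynomial]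
  exact ringKrullDim_eq_of_ringHom_isIntegral _ (h.quotientMap_isIntegral hx)
    (h.quotientMap_injective hx hu hreg)

/-- A locus of the dimension of the affine space to which it maps finitely has dense image in it. -/
lemma quotientMap_injective_of_locusDim {g : P.weylGroup} {x : AddChar X ℂ}
    (hx : IsCentralPoint P x)
    (hdim : locusDim g x = ({i | x (ϖ i) = 1} : Set b.support).ncard) :
    Function.Injective (quotientMap ϖ g x) := by
  by_contra hinj
  have h1 := ringKrullDim_lt_of_ringHom_isIntegral _ (h.quotientMap_isIntegral hx) hinj
  rw [show ringKrullDim _ = _ from hdim, ringKrullDim_mvPolynomial] at h1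
  have h2 : ({i | x (ϖ i) = 1} : Set b.support).ncard + 1 ≤
    ({i | x (ϖ i) = 1} : Set b.support).ncard := by exact_mod_cast h1
  lia

/-- If the orbit sums are algebraically independent on the locus of `g` then the locus meets every
orbit of the Weyl group that meets the locus of some `g'`. -/
lemma exists_smul_mem_locus {g g' : P.weylGroup} {x u : AddChar X ℂ} (hx : IsCentralPoint P x)
    (hinj : Function.Injective (quotientMap ϖ g x)) (hu : u ∈ locus g' x) :
    ∃ w : P.weylGroup, w • u ∈ locus g x := by
  obtain ⟨u', hu', H⟩ := h.exists_mem_locus_of_injective hx hinj fun i => ev u (orbitSum P (ϖ i))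
  obtain ⟨w, rfl⟩ := h.exists_smul_eq_of_ev_orbitSum_eq (u := u) (u' := u') fun i => by
    by_cases hi : x (ϖ i) = 1
    · exact (H i hi).symm
    · rw [ev_orbitSum_eq_zero hx hu hi, ev_orbitSum_eq_zero hx hu' hi]
  exact ⟨w, hu'⟩

/-- The loci of two elements of the Weyl group that both contain regular points belong to conjugate
elements. -/
lemma isConj_of_isRegularPoint {g g' : P.weylGroup} {x u u' : AddChar X ℂ}
    (hx : IsCentralPoint P x) (hu : u ∈ locus g x) (hreg : IsRegularPoint P u)
    (hu' : u' ∈ locus g' x) (hreg' : IsRegularPoint P u') : IsConj g' g := by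
  obtain ⟨w, hw⟩ := h.exists_smul_mem_locus hx (h.quotientMap_injective hx hu hreg) hu'
  have h1 := smul_mem_locus hx hu' w
  rw [isConj_iff]
  refine ⟨w, ?_⟩
  have h2 : (g⁻¹ * (w * g' * w⁻¹)) • w • u' = w • u' := by
    rw [mul_smul, show (w * g' * w⁻¹) • w • u' = x * w • u' from h1,
      ← show g • w • u' = x * w • u' from hw, inv_smul_smul]
  exact (inv_mul_eq_one.mp (hreg'.smul w _ h2)).symm

omit [Fintype P.weylGroup] in
/-- No root is trivial at the exponential of the sum of the positive coroots. -/
lemma expPoint_deg_apply_root_ne_one (i : ι) :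
    expPoint ((Int.castAddHom ℂ).comp (deg ϖ).toAddMonoidHom) (P.root i) ≠ 1 := by
  intro h1
  change Complex.exp ((deg ϖ (P.root i) : ℤ) : ℂ) = 1 at h1
  rw [← Complex.ofReal_intCast, ← Complex.ofReal_exp, Complex.ofReal_eq_one,
    Real.exp_eq_one_iff] at h1
  exact h.deg_root_ne_zero i (by exact_mod_cast h1)

/-- Some element of the Weyl group has a nonempty locus: the point at which the orbit sums of all
fundamental weights vanish is multiplied by `x` within its orbit. -/
lemma exists_locus_nonempty {x : AddChar X ℂ} (hx : IsCentralPoint P x) :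
    ∃ g : P.weylGroup, (locus g x).Nonempty := by
  have h1 : IsCentralPoint P (1 : AddChar X ℂ) := fun i => rfl
  obtain ⟨u, -, hu⟩ := h.exists_mem_locus_of_injective h1 (h.quotientMap_injective (g := 1) h1
    (show _ • _ = _ by rw [one_smul, one_mul])
    (h.isRegularPoint_of_forall_ne h.expPoint_deg_apply_root_ne_one)) 0
  obtain ⟨g, hg⟩ := h.exists_smul_eq_of_ev_orbitSum_eq (u := u) (u' := x * u) fun i => by
    rw [ev_mul_orbitSum hx, hu i rfl, Pi.zero_apply, mul_zero]
  exact ⟨g, u, hg.symm⟩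

end IsDualWeightBasis

end Dimension

/-! ### Regular points on maximal loci -/

section Maximal

open RootPairing

variable {ι X Y : Type*} [AddCommGroup X] [AddCommGroup Y]
  {P : RootPairing ι ℤ X Y} {b : P.Base} {ϖ : b.support → X}

lemma refl_mul_mem_locus {x u : AddChar X ℂ} (hx : IsCentralPoint P x) {w : P.weylGroup}
    (hu : u ∈ locus w x) {i : ι} (hi : u (P.root i) = 1) : u ∈ locus (refl P i * w) x := by
  change (refl P i * w) • u = x * u
  rw [mul_smul, show w • u = x * u from hu, smul_point_mul, hx.smul_eq, refl_smul_point hi]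

/-- An element whose locus contains `u` permutes the roots that are trivial at `u`. -/
lemma apply_root_smul_eq_one_iff {x u : AddChar X ℂ} (hx : IsCentralPoint P x) {w : P.weylGroup}
    (hu : u ∈ locus w x) (i : ι) : u (P.root (w⁻¹ • i)) = 1 ↔ u (P.root i) = 1 := by
  rw [← smul_root, ← smul_point_apply, show w • u = x * u from hu, AddChar.mul_apply, hx i, one_mul]

/-- The invariant form pairs the coroot of `i` with a functional `y` to a positive multiple of the
value of `y` at the root of `i`. -/
lemma two_mul_sum_coroot'_mul [Fintype ι] (i : ι) (y : X →ₗ[ℤ] ℤ) :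
    2 * ∑ k, P.coroot' i (P.root k) * y (P.root k) =
      y (P.root i) * ∑ k, P.coroot' i (P.root k) ^ 2 := by
  have h1 : ∑ k, P.coroot' i (P.root k) * y (P.root k) =
      ∑ k, P.coroot' i (P.root (refl P i • k)) * y (P.root (refl P i • k)) :=
    (Fintype.sum_bijective _ (MulAction.bijective (refl P i)) _ _ fun k => rfl).symm
  have h2 : ∀ k, P.coroot' i (P.root (refl P i • k)) * y (P.root (refl P i • k)) =
      y (P.root i) * P.coroot' i (P.root k) ^ 2 - P.coroot' i (P.root k) * y (P.root k) := by
    intro k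
    rw [← smul_root, refl_smul, map_sub, map_sub, map_smul, map_smul,
      root_coroot'_eq_pairing P i i, pairing_same]
    simp only [smul_eq_mul]
    ring
  rw [Finset.sum_congr rfl fun k _ => h2 k, Finset.sum_sub_distrib, ← Finset.mul_sum] at h1
  linarith

lemma sum_coroot'_sq_pos [Fintype ι] (i : ι) : 0 < ∑ k, P.coroot' i (P.root k) ^ 2 := by
  refine Finset.sum_pos' (fun k _ => sq_nonneg _) ⟨i, Finset.mem_univ _, ?_⟩
  rw [root_coroot'_eq_pairing, pairing_same]
  norm_num

namespace IsDualWeightBasis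

variable (h : IsDualWeightBasis b ϖ) [Fintype ι]
include h

lemma finiteDimensional_addMonoidHom : FiniteDimensional ℂ (X →+ ℂ) := by
  let f : (X →+ ℂ) →ₗ[ℂ] (b.support → ℂ) :=
    { toFun := fun z j => z (ϖ j)
      map_add' := fun y z => rfl
      map_smul' := fun c z => rfl }
  exact FiniteDimensional.of_injective f fun y z hyz => h.addMonoidHom_ext (congrFun hyz)

/-- Let `u` be a point of the locus of `g` such that some root is trivial at `u`, and suppose that
the roots trivial at `u` vanish on the space `V` fixed by `g`. Among the elements whose locus
contains `u` and that fix `V` pointwise there is one that permutes the positive roots trivial at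
`u`: any `w` for which the invariant form of `w (deg ϖ)` and `deg ϖ` is as large as possible will
do. It fixes the sum of the corresponding coroots, which is not in `V`. -/
lemma exists_lt_fixedSpace [Finite P.weylGroup] {g : P.weylGroup} {x u : AddChar X ℂ}
    (hx : IsCentralPoint P x) (hu : u ∈ locus g x)
    (hV : ∀ i, u (P.root i) = 1 → ∀ z ∈ fixedSpace g, z (P.root i) = 0)
    {i₀ : ι} (hi₀ : u (P.root i₀) = 1) :
    ∃ w : P.weylGroup, u ∈ locus w x ∧ fixedSpace g < fixedSpace w := by
  classical
  let H : Set P.weylGroup := {w | u ∈ locus w x ∧ fixedSpace g ≤ fixedSpace w}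
  let q : P.weylGroup → ℤ := fun w => ∑ k, deg ϖ (w⁻¹ • P.root k) * deg ϖ (P.root k)
  obtain ⟨w, ⟨hw1, hw2⟩, hmax⟩ := Set.exists_max_image H q (Set.toFinite _) ⟨g, hu, le_rfl⟩
  -- Otherwise multiplying `w` by the reflection in the root `i`, within `H`, would increase `q`.
  have hpos : ∀ i, u (P.root i) = 1 → 0 < deg ϖ (P.root i) → 0 < deg ϖ (P.root (w⁻¹ • i)) := by
    intro i hi hi0
    have h1 : refl P i * w ∈ H := by
      refine ⟨refl_mul_mem_locus hx hw1 hi, fun z hz l => ?_⟩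
      rw [mul_smul, refl_smul, map_sub, map_zsmul, hV i hi z hz, smul_zero, sub_zero, hw2 hz l]
    have h2 := hmax _ h1
    have h3 : q (refl P i * w) = q w -
        deg ϖ (P.root (w⁻¹ • i)) * ∑ k, P.coroot' i (P.root k) * deg ϖ (P.root k) := by
      simp only [q]
      rw [Finset.mul_sum, ← Finset.sum_sub_distrib]
      refine Finset.sum_congr rfl fun k _ => ?_
      rw [mul_inv_rev, refl_inv, mul_smul, refl_smul, smul_sub, smul_zsmul' w⁻¹, smul_root w⁻¹ i,
        map_sub, LinearMap.map_smul (deg ϖ), smul_eq_mul]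
      ring
    have h4 := two_mul_sum_coroot'_mul (P := P) i (deg ϖ)
    have h5 := sum_coroot'_sq_pos (P := P) i
    have h6 : 0 < ∑ k, P.coroot' i (P.root k) * deg ϖ (P.root k) := by
      have := mul_pos hi0 h5
      linarith
    have h7 := h.deg_root_ne_zero (w⁻¹ • i)
    have h8 : 0 ≤ deg ϖ (P.root (w⁻¹ • i)) * ∑ k, P.coroot' i (P.root k) * deg ϖ (P.root k) := by
      linarith
    exact lt_of_le_of_ne (nonneg_of_mul_nonneg_left h8 h6) h7.symm
  -- The sum `y` of the positive coroots that belong to roots trivial at `u` is fixed by `w`.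
  let D : Finset ι := {i | u (P.root i) = 1 ∧ 0 < deg ϖ (P.root i)}
  let y : X →ₗ[ℤ] ℤ := ∑ i ∈ D, P.coroot' i
  have hy : ∀ l, y l = ∑ i ∈ D, P.coroot' i l := fun l => by simp [y]
  have hyw : ∀ l, y (w • l) = y l := by
    intro l
    have hmaps : Set.MapsTo (w⁻¹ • · : ι → ι) D D := by
      intro i hi
      have hi' := (Finset.mem_filter.mp hi).2
      exact Finset.mem_filter.mpr ⟨Finset.mem_univ _,
        (apply_root_smul_eq_one_iff hx hw1 i).mpr hi'.1, hpos i hi'.1 hi'.2⟩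
    rw [hy, hy]
    refine Finset.sum_bij (fun i _ => w⁻¹ • i) (fun i hi => hmaps hi)
      (fun i _ j _ hij => smul_left_cancel _ hij) (fun j hj => ?_) fun i _ => coroot'_smul w i l
    obtain ⟨i, hi, rfl⟩ := (Finset.surjOn_of_injOn_of_card_le _ hmaps
      (fun i _ j _ hij => smul_left_cancel _ hij) le_rfl) hj
    exact ⟨i, hi, rfl⟩
  refine ⟨w, hw1, lt_of_le_of_ne hw2 fun heq => ?_⟩
  -- If `y` were in the space fixed by `g` then the roots occurring in it would vanish at `y`, so
  -- `y` would be orthogonal to itself, hence to `deg ϖ`, which is positive on all these roots.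
  have hyV : (Int.castAddHom ℂ).comp y.toAddMonoidHom ∈ fixedSpace g := by
    rw [heq]
    intro l
    exact congrArg (Int.cast : ℤ → ℂ) (hyw l)
  have hy0 : ∀ i ∈ D, y (P.root i) = 0 := by
    intro i hi
    have h1 := hV i (Finset.mem_filter.mp hi).2.1 _ hyV
    exact_mod_cast (show ((y (P.root i) : ℤ) : ℂ) = 0 from h1)
  have hform : ∀ y' : X →ₗ[ℤ] ℤ, 2 * ∑ k, y (P.root k) * y' (P.root k) =
      ∑ i ∈ D, y' (P.root i) * ∑ k, P.coroot' i (P.root k) ^ 2 := by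
    intro y'
    simp only [← two_mul_sum_coroot'_mul, hy, Finset.sum_mul, ← Finset.mul_sum]
    rw [Finset.sum_comm]
  have h1 : ∑ k, y (P.root k) * y (P.root k) = 0 := by
    have := hform y
    rw [Finset.sum_eq_zero (s := D) fun i hi => by rw [hy0 i hi, zero_mul]] at this
    linarith
  have h2 : ∀ k, y (P.root k) = 0 := fun k => mul_self_eq_zero.mp
    ((Finset.sum_eq_zero_iff_of_nonneg fun k _ => mul_self_nonneg _).mp h1 k (Finset.mem_univ k))
  have h3 := hform (deg ϖ)
  simp only [h2, zero_mul, Finset.sum_const_zero, mul_zero] at h3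
  obtain ⟨i₁, hi₁⟩ : ∃ i, i ∈ D := by
    rcases lt_or_gt_of_ne (h.deg_root_ne_zero i₀) with h4 | h4
    · refine ⟨refl P i₀ • i₀, ?_⟩
      have h5 : P.root (refl P i₀ • i₀) = - P.root i₀ := by
        rw [← smul_root, refl_smul, root_coroot'_eq_pairing, pairing_same, two_smul]
        abel
      simp [D, h5, hi₀, h4, AddChar.map_neg_eq_inv]
    · exact ⟨i₀, by simp [D, hi₀, h4]⟩
  exact (Finset.sum_pos (fun i hi => mul_pos (Finset.mem_filter.mp hi).2.2 (sum_coroot'_sq_pos i))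
    ⟨i₁, hi₁⟩).ne h3

/-- If the space fixed by `g` has the largest dimension among the elements with nonempty locus, then
every point of the locus of `g` can be moved to a regular point along a one-parameter subgroup
whose direction is fixed by `g`. -/
lemma exists_mul_expPoint_isRegularPoint [Fintype P.weylGroup] {g : P.weylGroup}
    {x v : AddChar X ℂ} (hx : IsCentralPoint P x)
    (hmax : ∀ w : P.weylGroup, (locus w x).Nonempty →
      Module.finrank ℂ (fixedSpace w) ≤ Module.finrank ℂ (fixedSpace g))
    (hv : v ∈ locus g x) :
    ∃ z ∈ fixedSpace g, IsRegularPoint P (v * expPoint z) := by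
  have := h.finiteDimensional_addMonoidHom
  let J := {i : ι // ∃ z ∈ fixedSpace g, z (P.root i) ≠ 0}
  let φ : J → Module.Dual ℂ (X →+ ℂ) := fun i =>
    { toFun := fun z => z (P.root i)
      map_add' := fun y z => rfl
      map_smul' := fun c z => rfl }
  -- A direction on which no root vanishes, except those that vanish on the whole fixed space.
  obtain ⟨z, hz, hzJ⟩ := Module.Dual.exists_forall_mem_ne_zero_of_forall_exists (fixedSpace g) φ
    fun i => i.2
  obtain ⟨t, ht⟩ : ∃ t : ℂ, ∀ i : J, v (P.root i) * Complex.exp (t * z (P.root i)) ≠ 1 := by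
    -- each root excludes only countably many parameters
    by_contra! hcon
    refine not_countable_complex ?_
    have h1 : ∀ i : J, {t : ℂ | v (P.root i) * Complex.exp (t * z (P.root i)) = 1}.Countable := by
      intro i
      have h2 : (Complex.exp ⁻¹' {(v (P.root i))⁻¹}).Countable :=
        Complex.countable_preimage_exp.mpr (Set.countable_singleton _)
      refine (h2.preimage_of_injOn (f := fun t : ℂ => t * z (P.root i))
        (mul_left_injective₀ (hzJ i)).injOn).mono fun t ht => ?_
      exact (inv_eq_of_mul_eq_one_right ht).symm
    refine (Set.countable_iUnion h1).mono fun t _ => Set.mem_iUnion.mpr (hcon t)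
  refine ⟨t • z, Submodule.smul_mem _ _ hz, h.isRegularPoint_of_forall_ne fun i₀ hi₀ => ?_⟩
  have hu := mul_expPoint_mem_locus hv (Submodule.smul_mem _ t hz)
  obtain ⟨w, hw, hlt⟩ := h.exists_lt_fixedSpace hx hu (fun i hi y hy => by
    by_contra hyi
    exact ht ⟨i, y, hy, hyi⟩ hi) hi₀
  exact (hmax w ⟨_, hw⟩).not_gt (Submodule.finrank_lt_finrank_of_lt hlt)

/-- If the locus of `g` is nonempty and the space fixed by `g` is as large as possible, then the
locus contains a regular point. -/
lemma exists_isRegularPoint_mem_locus [Fintype P.weylGroup] {x : AddChar X ℂ}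
    (hx : IsCentralPoint P x) : ∃ g : P.weylGroup, ∃ u ∈ locus g x, IsRegularPoint P u := by
  obtain ⟨g, ⟨v, hv⟩, hmax⟩ := Set.exists_max_image {g : P.weylGroup | (locus g x).Nonempty}
    (fun g => Module.finrank ℂ (fixedSpace g)) (Set.toFinite _) (h.exists_locus_nonempty hx)
  obtain ⟨z, hz, hreg⟩ := h.exists_mul_expPoint_isRegularPoint hx hmax hv
  exact ⟨g, _, mul_expPoint_mem_locus hv hz, hreg⟩

/-- If the locus of `g` contains a regular point then the space fixed by `g` has the largest
possible dimension, hence every point of the locus can be moved to a regular point. -/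
lemma exists_mul_expPoint_of_isRegularPoint [Fintype P.weylGroup] {g : P.weylGroup}
    {x u v : AddChar X ℂ} (hx : IsCentralPoint P x) (hu : u ∈ locus g x)
    (hreg : IsRegularPoint P u) (hv : v ∈ locus g x) :
    ∃ z ∈ fixedSpace g, IsRegularPoint P (v * expPoint z) := by
  obtain ⟨g₀, ⟨v₀, hv₀⟩, hmax⟩ := Set.exists_max_image {g : P.weylGroup | (locus g x).Nonempty}
    (fun g => Module.finrank ℂ (fixedSpace g)) (Set.toFinite _) (h.exists_locus_nonempty hx)
  obtain ⟨z, hz, hreg₀⟩ := h.exists_mul_expPoint_isRegularPoint hx hmax hv₀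
  refine h.exists_mul_expPoint_isRegularPoint hx (fun w hw => ?_) hv
  rw [h.finrank_fixedSpace hx hu hreg,
    ← h.finrank_fixedSpace hx (mul_expPoint_mem_locus hv₀ hz) hreg₀]
  exact hmax w hw

/-- The elements whose locus contains a regular point form a single conjugacy class. -/
lemma exists_forall_isRegularPoint_iff_isConj [Fintype P.weylGroup] {x : AddChar X ℂ}
    (hx : IsCentralPoint P x) : ∃ g₀ : P.weylGroup, ∀ g : P.weylGroup,
      (∃ u ∈ locus g x, IsRegularPoint P u) ↔ IsConj g₀ g := by
  obtain ⟨g₀, u₀, hu₀, hreg₀⟩ := h.exists_isRegularPoint_mem_locus hx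
  refine ⟨g₀, fun g => ⟨?_, fun hconj => ?_⟩⟩
  · rintro ⟨u, hu, hreg⟩
    exact h.isConj_of_isRegularPoint hx hu hreg hu₀ hreg₀
  · obtain ⟨w, rfl⟩ := isConj_iff.mp hconj
    exact ⟨w • u₀, smul_mem_locus hx hu₀ w, hreg₀.smul w⟩

/-- A locus of the largest possible dimension meets every orbit that meets some locus, in particular
an orbit of regular points. -/
lemma exists_isRegularPoint_of_locusDim [Fintype P.weylGroup] {g : P.weylGroup}
    {x : AddChar X ℂ} (hx : IsCentralPoint P x)
    (hdim : locusDim g x = ({i | x (ϖ i) = 1} : Set b.support).ncard) :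
    ∃ u ∈ locus g x, IsRegularPoint P u := by
  obtain ⟨g₀, u₀, hu₀, hreg⟩ := h.exists_isRegularPoint_mem_locus hx
  obtain ⟨w, hw⟩ :=
    h.exists_smul_mem_locus hx (h.quotientMap_injective_of_locusDim hx hdim) hu₀
  exact ⟨w • u₀, hw, hreg.smul w⟩

end IsDualWeightBasis

end Maximal

/-! ### Dimension of a locus in the Zariski topology -/

section ZariskiDimension

open AddMonoidAlgebra RootPairing Topology TopologicalSpace

/-- If every closed subset of `Y` is the closure of its intersection with the image of an inducing
map `f : S → Y`, then `S` and `Y` have the same Krull dimension. -/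
lemma topologicalKrullDim_eq_of_isInducing {S Y : Type*} [TopologicalSpace S] [TopologicalSpace Y]
    {f : S → Y} (hf : IsInducing f)
    (hd : ∀ Z : Set Y, IsClosed Z → Z ⊆ closure (Z ∩ Set.range f)) :
    topologicalKrullDim S = topologicalKrullDim Y := by
  refine le_antisymm hf.topologicalKrullDim_le ?_
  have hirr : ∀ Z : IrreducibleCloseds Y, IsIrreducible (f ⁻¹' (Z : Set Y)) := by
    intro Z
    refine ⟨?_, ?_⟩
    · obtain ⟨y, hy⟩ := Z.isIrreducible.nonempty
      obtain ⟨_, hs, s, rfl⟩ := closure_nonempty_iff.mp ⟨y, hd _ Z.isClosed hy⟩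
      exact ⟨s, hs⟩
    · intro U V hU hV hZU hZV
      obtain ⟨U', hU', rfl⟩ := hf.isOpen_iff.mp hU
      obtain ⟨V', hV', rfl⟩ := hf.isOpen_iff.mp hV
      obtain ⟨s, hs1, hs2⟩ := hZU
      obtain ⟨t, ht1, ht2⟩ := hZV
      obtain ⟨y, hy, hyUV⟩ := Z.isIrreducible.isPreirreducible U' V' hU' hV' ⟨f s, hs1, hs2⟩
        ⟨f t, ht1, ht2⟩
      obtain ⟨_, hr, hrZ, r, rfl⟩ := mem_closure_iff.mp (hd _ Z.isClosed hy) _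
        (hU'.inter hV') hyUV
      exact ⟨r, hrZ, hr⟩
  let F : IrreducibleCloseds Y → IrreducibleCloseds S := fun Z =>
    ⟨f ⁻¹' Z, hirr Z, Z.isClosed.preimage hf.continuous⟩
  refine Order.krullDim_le_of_strictMono F (Monotone.strictMono_of_injective ?_ ?_)
  · intro Z Z' hZ s hs
    exact hZ hs
  · have key : ∀ Z Z' : IrreducibleCloseds Y, F Z = F Z' → (Z : Set Y) ⊆ Z' := by
      intro Z Z' hZ
      refine (hd _ Z.isClosed).trans (closure_minimal ?_ Z'.isClosed)
      rintro _ ⟨hs, s, rfl⟩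
      have h1 : s ∈ F Z' := hZ ▸ (show s ∈ F Z from hs)
      exact h1
    intro Z Z' hZ
    exact IrreducibleCloseds.ext ((key _ _ hZ).antisymm (key _ _ hZ.symm))

/-- The point of the spectrum of the group algebra that belongs to a point of the torus. -/
def toSpec {X : Type*} [AddCommGroup X] (u : AddChar X ℂ) :
    PrimeSpectrum (AddMonoidAlgebra ℂ X) :=
  ⟨RingHom.ker (ev u), RingHom.ker_isPrime _⟩

variable {ι X Y : Type*} [AddCommGroup X] [AddCommGroup Y]
  {P : RootPairing ι ℤ X Y} {b : P.Base} {ϖ : b.support → X}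

namespace IsDualWeightBasis

lemma finiteType_addMonoidAlgebra (h : IsDualWeightBasis b ϖ) :
    Algebra.FiniteType ℂ (AddMonoidAlgebra ℂ X) := by
  have : Module.Finite ℤ X := by
    refine Module.Finite.of_surjective (Fintype.linearCombination ℤ ϖ) fun l => ?_
    exact ⟨fun j => P.coroot' j l, by rw [Fintype.linearCombination_apply, h.sum_smul]⟩
  have : AddMonoid.FG X :=
    AddGroup.fg_iff_addMonoid_fg.mp (Module.Finite.iff_addGroup_fg.mp inferInstance)
  infer_instance

/-- The Krull dimension of a locus in the Zariski topology is the Krull dimension of its coordinate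
ring. -/
lemma topologicalKrullDim_locus (h : IsDualWeightBasis b ϖ) {T : Type*} [TopologicalSpace T]
    {f : T → AddChar X ℂ} (hf : Function.Surjective f) (hind : IsInducing (toSpec ∘ f))
    (g : P.weylGroup) (x : AddChar X ℂ) :
    topologicalKrullDim (f ⁻¹' locus g x) = locusDim g x := by
  rw [locusDim, ← PrimeSpectrum.topologicalKrullDim_eq_ringKrullDim]
  let R := AddMonoidAlgebra ℂ X ⧸ vanishingIdeal (locus g x)
  let evQ : f ⁻¹' locus g x → (R →ₐ[ℂ] ℂ) := fun s =>
    Ideal.Quotient.liftₐ _ (ev (f s)) fun F hF => mem_vanishingIdeal.mp hF _ s.2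
  let k : f ⁻¹' locus g x → PrimeSpectrum R := fun s =>
    ⟨RingHom.ker (evQ s), RingHom.ker_isPrime _⟩
  have hcl : IsClosedEmbedding (PrimeSpectrum.comap (Ideal.Quotient.mk
      (vanishingIdeal (locus g x)))) :=
    PrimeSpectrum.isClosedEmbedding_comap_of_surjective _ _ Ideal.Quotient.mk_surjective
  have hk : PrimeSpectrum.comap (Ideal.Quotient.mk _) ∘ k = (toSpec ∘ f) ∘ Subtype.val := rfl
  have hki : IsInducing k := by
    rw [← hcl.isInducing.of_comp_iff, hk]
    exact hind.comp IsInducing.subtypeVal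
  have := h.finiteType_addMonoidAlgebra
  have hR : Algebra.FiniteType ℂ R :=
    Algebra.FiniteType.of_surjective (Ideal.Quotient.mkₐ ℂ _) Ideal.Quotient.mk_surjective
  have hJ : IsJacobsonRing R := isJacobsonRing_of_finiteType (A := ℂ)
  refine topologicalKrullDim_eq_of_isInducing hki fun Z hZ => ?_
  nth_rw 1 [← JacobsonSpace.closure_inter_closedPoints hZ]
  refine closure_mono ?_
  rintro Q ⟨hQZ, hQ⟩
  refine ⟨hQZ, ?_⟩
  -- By the Nullstellensatz the closed points of the spectrum are points of the torus.
  have hQ' : Q.asIdeal.IsMaximal := (PrimeSpectrum.isClosed_singleton_iff_isMaximal _).mp hQ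
  let K := R ⧸ Q.asIdeal
  let _ : Field K := Ideal.Quotient.field Q.asIdeal
  have hK : Algebra.FiniteType ℂ K :=
    Algebra.FiniteType.of_surjective (Ideal.Quotient.mkₐ ℂ _) Ideal.Quotient.mk_surjective
  have hfin : Module.Finite ℂ K := finite_of_finite_type_of_isJacobsonRing ℂ K
  let e : ℂ ≃ₐ[ℂ] K := AlgEquiv.ofBijective (Algebra.ofId ℂ K)
    (IsAlgClosed.algebraMap_bijective_of_isIntegral (k := ℂ) (K := K))
  let θ : R →ₐ[ℂ] ℂ := (e.symm : K →ₐ[ℂ] ℂ).comp (Ideal.Quotient.mkₐ ℂ Q.asIdeal)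
  obtain ⟨u, hu⟩ := exists_ev_eq (θ.comp (Ideal.Quotient.mkₐ ℂ (vanishingIdeal (locus g x))))
  have hul : u ∈ locus g x := mem_locus_of_vanishing fun F hF => by
    rw [hu, AlgHom.comp_apply, Ideal.Quotient.mkₐ_eq_mk, Ideal.Quotient.eq_zero_iff_mem.mpr hF,
      map_zero]
  obtain ⟨s, rfl⟩ := hf u
  refine ⟨⟨s, hul⟩, ?_⟩
  have h1 : evQ ⟨s, hul⟩ = θ := by
    refine Ideal.Quotient.algHom_ext _ ?_
    rw [← hu]
    ext
    rfl
  ext F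
  change evQ ⟨s, hul⟩ F = 0 ↔ _
  rw [h1]
  change e.symm _ = 0 ↔ _
  rw [map_eq_zero_iff _ e.symm.injective]
  exact Ideal.Quotient.eq_zero_iff_mem

end IsDualWeightBasis

end ZariskiDimension

/-! ### Points of an algebraic torus -/

section Torus

open AddMonoidAlgebra Topology TopologicalSpace

variable {N : ℕ} {A : Subgroup (GL (Fin N) ℂ)}

/-- The points of the torus with character lattice `X`. -/
abbrev TorusPoint (X : Type*) [AddCommGroup X] : Type _ := AddChar X ℂ

/-- The Lie algebra of the torus with character lattice `X`. -/
abbrev TorusLie (X : Type*) [AddCommGroup X] : Type _ := X →+ ℂ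

lemma apply_sum_zsmul {X κ : Type*} [AddCommGroup X] (u : TorusPoint X) (s : Finset κ) (n : κ → ℤ)
    (l : κ → X) : u (∑ k ∈ s, n k • l k) = ∏ k ∈ s, u (l k) ^ n k := by
  refine (map_prod u.toMonoidHom (fun k => Multiplicative.ofAdd (n k • l k)) s).trans ?_
  exact Finset.prod_congr rfl fun k _ => AddChar.map_zsmul_eq_zpow u _ _

/-- An element of a torus, as a character of the character group. -/
def point (a : A) : TorusPoint (Characters A) where
  toFun χ := (χ.1.toMul a : ℂ)
  map_zero_eq_one' := rfl
  map_add_eq_mul' χ ψ := by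
    change ((χ.1.toMul a * ψ.1.toMul a : ℂˣ) : ℂ) = _
    rw [Units.val_mul]

lemma point_apply (a : A) (χ : Characters A) : point a χ = (χ.1.toMul a : ℂ) := rfl

lemma point_mul (a b : A) : point (a * b) = point a * point b := by
  ext χ
  rw [AddChar.mul_apply, point_apply, map_mul, Units.val_mul]
  rfl

/-- The Laurent monomial with given exponents, as a character of `(ℂˣ)ʳ`. -/
def laurentMonomial {r : ℕ} (n : Fin r → ℤ) : (Fin r → ℂˣ) →* ℂ :=
  (Units.coeHom ℂ).comp
    { toFun := fun t => ∏ i, t i ^ n i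
      map_one' := by simp
      map_mul' := fun s t => by simp [mul_zpow, Finset.prod_mul_distrib] }

lemma laurentMonomial_apply {r : ℕ} (n : Fin r → ℤ) (t : Fin r → ℂˣ) :
    laurentMonomial n t = ((∏ i, t i ^ n i : ℂˣ) : ℂ) := rfl

lemma IsLaurentFun.mem_span {r : ℕ} {f : (Fin r → ℂˣ) → ℂ} (hf : IsLaurentFun f) :
    f ∈ Submodule.span ℂ
      (Set.range fun n : Fin r → ℤ => (laurentMonomial n : (Fin r → ℂˣ) → ℂ)) := by
  obtain ⟨p, hp⟩ := hf
  rw [show f = _ from funext hp]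
  clear hp
  set V := Submodule.span ℂ
    (Set.range fun n : Fin r → ℤ => (laurentMonomial n : (Fin r → ℂˣ) → ℂ)) with hV
  have hmul : ∀ (m : Fin r → ℤ) (f : (Fin r → ℂˣ) → ℂ), f ∈ V →
      f * (laurentMonomial m : (Fin r → ℂˣ) → ℂ) ∈ V := by
    intro m f hf
    induction hf using Submodule.span_induction with
    | mem f hf =>
      obtain ⟨n, rfl⟩ := hf
      refine Submodule.subset_span ⟨n + m, ?_⟩
      ext t
      simp [laurentMonomial_apply, zpow_add₀, Finset.prod_mul_distrib]
    | zero => rw [zero_mul]; exact zero_mem _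
    | add f g _ _ h1 h2 => rw [add_mul]; exact add_mem h1 h2
    | smul c f _ h1 => rw [smul_mul_assoc]; exact Submodule.smul_mem _ _ h1
  induction p using MvPolynomial.induction_on with
  | C c =>
    have h1 : (laurentMonomial 0 : (Fin r → ℂˣ) → ℂ) ∈ V := Submodule.subset_span ⟨0, rfl⟩
    convert Submodule.smul_mem V c h1 using 1
    ext t
    simp [laurentMonomial_apply]
  | add p q hp hq =>
    convert add_mem hp hq using 1
    ext t
    simp
  | mul_X p s hp =>
    rcases s with i | i
    · convert hmul (Pi.single i 1) _ hp using 1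
      ext t
      rw [map_mul, MvPolynomial.eval_X, Pi.mul_apply, laurentMonomial_apply,
        Fintype.prod_eq_single i fun k hk => by rw [Pi.single_eq_of_ne hk, zpow_zero],
        Pi.single_eq_same, zpow_one, Sum.elim_inl]
    · convert hmul (Pi.single i (-1)) _ hp using 1
      ext t
      rw [map_mul, MvPolynomial.eval_X, Pi.mul_apply, laurentMonomial_apply,
        Fintype.prod_eq_single i fun k hk => by rw [Pi.single_eq_of_ne hk, zpow_zero],
        Pi.single_eq_same, zpow_neg_one, Sum.elim_inr]

/-- A character of `(ℂˣ)ʳ` that is a Laurent polynomial is a Laurent monomial, by the linear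
independence of characters. -/
lemma exists_eq_laurentMonomial {r : ℕ} {ψ : (Fin r → ℂˣ) →* ℂ} (hψ : IsLaurentFun ψ) :
    ∃ n, ψ = laurentMonomial n := by
  by_contra! hne
  have h1 := (linearIndependent_monoidHom (Fin r → ℂˣ) ℂ).notMem_span_image
    (s := Set.range laurentMonomial) (x := ψ) (fun ⟨n, hn⟩ => hne n hn.symm)
  refine h1 ?_
  rw [← Set.range_comp]
  exact hψ.mem_span

lemma isLaurentFun_eval {r : ℕ} {κ : Type*} {f : κ → (Fin r → ℂˣ) → ℂ}
    (hf : ∀ k, IsLaurentFun (f k)) (p : MvPolynomial κ ℂ) :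
    IsLaurentFun fun t => MvPolynomial.eval (fun k => f k t) p := by
  choose q hq using hf
  refine ⟨MvPolynomial.bind₁ q p, fun t => ?_⟩
  simp only [hq]
  exact (MvPolynomial.eval₂Hom_bind₁ (RingHom.id ℂ) _ q p).symm

/-- Coordinates on a torus, i.e. the data whose existence `IsTorus` asserts. -/
structure TorusCoordinates (A : Subgroup (GL (Fin N) ℂ)) (r : ℕ) where
  /-- The isomorphism with `(ℂˣ)ʳ`. -/
  toEquiv : (Fin r → ℂˣ) ≃* A
  laurent : ∀ i j, IsLaurentFun fun t =>
    ((toEquiv t : GL (Fin N) ℂ) : Matrix (Fin N) (Fin N) ℂ) i j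
  regular : ∀ k, IsRegularFun A fun a => ((toEquiv.symm a k : ℂˣ) : ℂ)

namespace TorusCoordinates

variable {r : ℕ} (e : TorusCoordinates A r)

/-- The coordinates of a torus, as characters. -/
def coord (k : Fin r) : Characters A :=
  ⟨Additive.ofMul ((Pi.evalMonoidHom _ k).comp e.toEquiv.symm.toMonoidHom), e.regular k⟩

lemma coord_apply (k : Fin r) (a : A) : (e.coord k).1.toMul a = e.toEquiv.symm a k := rfl

lemma isLaurentFun_of_isRegularFun {f : A → ℂ} (hf : IsRegularFun A f) :
    IsLaurentFun fun t => f (e.toEquiv t) := by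
  obtain ⟨p, hp⟩ := hf
  simp only [hp]
  refine isLaurentFun_eval (f := fun s t => Sum.elim _ _ s) ?_ p
  rintro (⟨i, j⟩ | ⟨i, j⟩)
  · exact e.laurent i j
  · have := (e.laurent i j).comp_inv
    simpa using this

/-- The coordinates generate the character group. -/
lemma exists_eq_sum_coord (χ : Characters A) : ∃ n : Fin r → ℤ, χ = ∑ k, n k • e.coord k := by
  obtain ⟨n, hn⟩ := exists_eq_laurentMonomial
    (ψ := (Units.coeHom ℂ).comp (χ.1.toMul.comp e.toEquiv.toMonoidHom))
    (e.isLaurentFun_of_isRegularFun χ.2)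
  refine ⟨n, Subtype.ext (Additive.toMul.injective (MonoidHom.ext fun a => Units.ext ?_))⟩
  have h1 := DFunLike.congr_fun hn (e.toEquiv.symm a)
  rw [laurentMonomial_apply] at h1
  have h2 : (χ.1.toMul (e.toEquiv (e.toEquiv.symm a)) : ℂ) =
    ((∏ k, e.toEquiv.symm a k ^ n k : ℂˣ) : ℂ) := h1
  rw [MulEquiv.apply_symm_apply] at h2
  change _ = point a (∑ k, n k • e.coord k)
  rw [h2, apply_sum_zsmul, Units.coe_prod]
  exact Finset.prod_congr rfl fun k _ => Units.val_zpow_eq_zpow_val _ _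

include e in
/-- The points of a torus are the characters of its character group. -/
lemma point_bijective : Function.Bijective (point : A → TorusPoint (Characters A)) := by
  constructor
  · intro a b hab
    refine e.toEquiv.symm.injective (funext fun k => Units.ext ?_)
    exact DFunLike.congr_fun hab (e.coord k)
  · intro u
    refine ⟨e.toEquiv fun k => (u.val_isUnit (e.coord k)).unit, ?_⟩
    ext χ
    obtain ⟨n, rfl⟩ := e.exists_eq_sum_coord χ
    rw [apply_sum_zsmul, apply_sum_zsmul]
    refine Finset.prod_congr rfl fun k _ => ?_
    rw [point_apply, coord_apply, MulEquiv.symm_apply_apply]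
    rfl

include e in
/-- The polynomials in the matrix entries are, on a torus, elements of the group algebra of the
character group. -/
lemma exists_ev_eq_evalEntries (p : MvPolynomial (Fin N × Fin N) ℂ) :
    ∃ F : AddMonoidAlgebra ℂ (Characters A), ∀ a : A, ev (point a) F = evalEntries p a := by
  choose q hq using e.laurent
  let c : Fin r ⊕ Fin r → AddMonoidAlgebra ℂ (Characters A) :=
    Sum.elim (fun k => single (e.coord k) 1) fun k => single (-e.coord k) 1
  refine ⟨MvPolynomial.aeval (fun ij : Fin N × Fin N => MvPolynomial.aeval c (q ij.1 ij.2)) p,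
    fun a => ?_⟩
  have hc : (fun s => ev (point a) (c s)) = Sum.elim (fun k => ((e.toEquiv.symm a k : ℂˣ) : ℂ))
      fun k => (((e.toEquiv.symm a k)⁻¹ : ℂˣ) : ℂ) := by
    funext s
    rcases s with k | k
    · simp [c, point_apply, coord_apply]
    · simp [c, AddChar.map_neg_eq_inv, point_apply, coord_apply]
  rw [ev_aeval, evalEntries]
  congr 2
  funext ij
  have h1 := hq ij.1 ij.2 (e.toEquiv.symm a)
  beta_reduce at h1
  rw [MulEquiv.apply_symm_apply] at h1
  rw [ev_aeval, hc, h1]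

end TorusCoordinates

/-- The product of a regular function with a power of the determinant is a polynomial in the matrix
entries. -/
lemma IsRegularFun.exists_det_pow_mul {f : A → ℂ} (hf : IsRegularFun A f) :
    ∃ (n : ℕ) (p : MvPolynomial (Fin N × Fin N) ℂ), ∀ a : A, evalEntries p a =
      ((a : GL (Fin N) ℂ) : Matrix (Fin N) (Fin N) ℂ).det ^ n * f a := by
  obtain ⟨p, hp⟩ := hf
  simp only [hp]
  clear hp
  let M := Matrix.mvPolynomialX (Fin N) (Fin N) ℂ
  have hM : ∀ a : GL (Fin N) ℂ, (MvPolynomial.eval fun ij : Fin N × Fin N =>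
      (a : Matrix (Fin N) (Fin N) ℂ) ij.1 ij.2).mapMatrix M = a := by
    intro a
    ext i j
    simp [M]
  have hdet : ∀ a : GL (Fin N) ℂ, evalEntries M.det a = (a : Matrix (Fin N) (Fin N) ℂ).det := by
    intro a
    rw [evalEntries, RingHom.map_det, hM]
  induction p using MvPolynomial.induction_on with
  | C c => exact ⟨0, MvPolynomial.C c, fun a => by simp [evalEntries]⟩
  | add p q hp hq =>
    obtain ⟨n, p', hp'⟩ := hp
    obtain ⟨m, q', hq'⟩ := hq
    refine ⟨n + m, p' * M.det ^ m + q' * M.det ^ n, fun a => ?_⟩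
    have h1 := hp' a
    have h2 := hq' a
    have h3 := hdet a
    simp only [evalEntries] at h1 h2 h3 ⊢
    simp only [map_add, map_mul, map_pow, h1, h2, h3]
    ring
  | mul_X p s hp =>
    obtain ⟨n, p', hp'⟩ := hp
    rcases s with ⟨i, j⟩ | ⟨i, j⟩
    · refine ⟨n, p' * MvPolynomial.X (i, j), fun a => ?_⟩
      have h1 := hp' a
      simp only [evalEntries] at h1 ⊢
      simp only [map_mul, h1, MvPolynomial.eval_X, Sum.elim_inl]
      ring
    · refine ⟨n + 1, p' * M.adjugate i j, fun a => ?_⟩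
      have h1 := hp' a
      have h2 : (MvPolynomial.eval fun ij : Fin N × Fin N =>
          ((a : GL (Fin N) ℂ) : Matrix (Fin N) (Fin N) ℂ) ij.1 ij.2) (M.adjugate i j) =
          ((a : GL (Fin N) ℂ) : Matrix (Fin N) (Fin N) ℂ).adjugate i j := by
        rw [← hM a, ← RingHom.map_adjugate, hM a]
        rfl
      have h3 : ((a : GL (Fin N) ℂ) : Matrix (Fin N) (Fin N) ℂ).adjugate i j =
          ((a : GL (Fin N) ℂ) : Matrix (Fin N) (Fin N) ℂ).det *
          (((a : GL (Fin N) ℂ)⁻¹ : GL (Fin N) ℂ) : Matrix (Fin N) (Fin N) ℂ) i j := by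
        rw [Matrix.coe_units_inv, Matrix.inv_def, Matrix.smul_apply, smul_eq_mul, ← mul_assoc,
          Ring.mul_inverse_cancel _ ((Matrix.isUnit_iff_isUnit_det _).mp
            (a : GL (Fin N) ℂ).isUnit), one_mul]
      simp only [evalEntries] at h1 ⊢
      simp only [map_mul, h1, h2, h3, MvPolynomial.eval_X, Sum.elim_inr]
      ring

lemma exists_det_pow_mul_ev (F : AddMonoidAlgebra ℂ (Characters A)) :
    ∃ (n : ℕ) (p : MvPolynomial (Fin N × Fin N) ℂ), ∀ a : A, evalEntries p a =
      ((a : GL (Fin N) ℂ) : Matrix (Fin N) (Fin N) ℂ).det ^ n * ev (point a) F := by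
  have h1 : IsRegularFun A fun a => ev (point a) F := by
    induction F using AddMonoidAlgebra.induction_linear with
    | zero => exact ⟨0, by simp⟩
    | add F F' h1 h2 =>
      obtain ⟨p, hp⟩ := h1
      obtain ⟨q, hq⟩ := h2
      refine ⟨p + q, fun a => ?_⟩
      rw [MvPolynomial.eval_add, ← hp, ← hq]
      exact map_add (ev (point a)) F F'
    | single χ c =>
      obtain ⟨p, hp⟩ := χ.2
      refine ⟨MvPolynomial.C c * p, fun a => ?_⟩
      rw [MvPolynomial.eval_mul, MvPolynomial.eval_C, ← hp]
      exact ev_single _ _ _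
  exact h1.exists_det_pow_mul

/-- The Zariski topology of a torus is induced from the spectrum of the group algebra of the
character group. -/
lemma TorusCoordinates.zariski_eq {r : ℕ} (e : TorusCoordinates A r) :
    zariski A = TopologicalSpace.induced (toSpec ∘ point) inferInstance := by
  rw [PrimeSpectrum.isTopologicalBasis_basic_opens.eq_generateFrom, zariski, zariskiGL,
    induced_generateFrom_eq, induced_generateFrom_eq]
  refine le_antisymm (le_generateFrom ?_) (le_generateFrom ?_)
  · rintro _ ⟨_, ⟨F, rfl⟩, rfl⟩
    obtain ⟨n, p, hp⟩ := exists_det_pow_mul_ev F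
    refine GenerateOpen.basic _ ⟨_, ⟨p, rfl⟩, ?_⟩
    ext a
    change evalEntries p a ≠ 0 ↔ ev (point a) F ≠ 0
    rw [hp, mul_ne_zero_iff]
    exact and_iff_right (pow_ne_zero _ ((Matrix.isUnit_iff_isUnit_det _).mp
      (a : GL (Fin N) ℂ).isUnit).ne_zero)
  · rintro _ ⟨_, ⟨p, rfl⟩, rfl⟩
    obtain ⟨F, hF⟩ := e.exists_ev_eq_evalEntries p
    refine GenerateOpen.basic _ ⟨_, ⟨F, rfl⟩, ?_⟩
    ext a
    change ev (point a) F ≠ 0 ↔ evalEntries p a ≠ 0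
    rw [hF]

/-- The one-parameter families of points, defined by exponentials, are connected. -/
lemma TorusCoordinates.isPreconnected_range {r : ℕ} (e : TorusCoordinates A r)
    (u : TorusPoint (Characters A)) (z : TorusLie (Characters A)) {γ : ℂ → A}
    (hγ : ∀ t, point (γ t) = u * expPoint (t • z)) :
    @IsPreconnected A (zariski A) (Set.range γ) := by
  let _ := zariski A
  refine _root_.isPreconnected_range ?_
  rw [continuous_iff_le_induced, e.zariski_eq,
    PrimeSpectrum.isTopologicalBasis_basic_opens.eq_generateFrom, induced_generateFrom_eq,
    ← continuous_iff_le_induced, continuous_generateFrom_iff]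
  rintro _ ⟨_, ⟨F, rfl⟩, rfl⟩
  have h1 : Continuous fun t => ev (point (γ t)) F := by
    induction F using AddMonoidAlgebra.induction_linear with
    | zero => simpa using continuous_const
    | add F F' h1 h2 =>
      simp only [map_add]
      exact h1.add h2
    | single χ c =>
      simp only [ev_single, hγ, AddChar.mul_apply, expPoint_apply, AddMonoidHom.smul_apply]
      fun_prop
  exact h1.isOpen_preimage _ isOpen_compl_singleton

end Torus

/-! ### The Weyl group and the centre of a matrix group -/

section Group

open RootPairing

variable {N : ℕ} {G A : Subgroup (GL (Fin N) ℂ)} [IsMulCommutative A] {ι : Type*}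
  {P : RootDatum ι (Characters A) (Cocharacters A)} {b : P.Base} {ϖ : b.support → Characters A}

/-- In a simply connected group the fundamental weights form a basis of the character lattice. -/
lemma IsFundamentalWeights.isDualWeightBasis (hϖ : IsFundamentalWeights P b ϖ)
    (hsc : IsSimplyConnected P) : IsDualWeightBasis b ϖ where
  coroot'_apply i j := by
    split_ifs with hij
    · subst hij
      exact hϖ.1 i
    · exact hϖ.2 i j hij
  sum_smul l := by
    classical
    refine P.toPerfPair.injective (LinearMap.ext_on (b.span_int_coroot_support.trans hsc) ?_)
    rintro _ ⟨i, hi, rfl⟩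
    have hi' : ∀ j : b.support, P.toLinearMap (ϖ j) (P.coroot i) =
        if j = ⟨i, hi⟩ then 1 else 0 := by
      intro j
      split_ifs with hj
      · subst hj
        exact hϖ.1 _
      · exact hϖ.2 j ⟨i, hi⟩ hj
    have h1 : P.toLinearMap (∑ j : b.support, P.coroot' j l • ϖ j) (P.coroot i) =
        ∑ j : b.support, P.coroot' j l * P.toLinearMap (ϖ j) (P.coroot i) := by
      simp
    refine h1.trans ?_
    simp only [hi', mul_ite, mul_one, mul_zero, Finset.sum_ite_eq', Finset.mem_univ, if_true]
    rfl

/-- An element that commutes with all of `G` is in the kernel of all roots, because it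
acts trivially on the tangent space. -/
lemma isCentralPoint_point (hP : IsRootDatumOf G P) {x : A}
    (hx : ∀ y ∈ G, (x : GL (Fin N) ℂ) * y = y * x) : IsCentralPoint P (point x) := by
  intro i
  obtain ⟨-, X, hX, hX0, hXa⟩ : IsRoot G A (P.root i) := hP.range_root.le ⟨i, rfl⟩
  set M : Matrix (Fin N) (Fin N) ℂ := ((x : GL (Fin N) ℂ) : Matrix (Fin N) (Fin N) ℂ)
  have hcomm : M * X = X * M := by
    ext i j
    -- the polynomials that express that a matrix commutes with `x`
    have h1 := hX (∑ k, (MvPolynomial.C (M i k) * MvPolynomial.X (k, j) -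
      MvPolynomial.C (M k j) * MvPolynomial.X (i, k))) fun g hg => by
        have h2 := congrArg (fun y : GL (Fin N) ℂ => (y : Matrix (Fin N) (Fin N) ℂ) i j) (hx g hg)
        simp only [Units.val_mul, Matrix.mul_apply] at h2
        simp only [evalEntries, map_sum, map_sub, map_mul, MvPolynomial.eval_C,
          MvPolynomial.eval_X, Finset.sum_sub_distrib]
        rw [sub_eq_zero]
        exact h2.trans (Finset.sum_congr rfl fun k _ => mul_comm _ _)
    have h2 : ∀ (c : ℂ) (s t : Fin N × Fin N), evalEntries (MvPolynomial.pderiv s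
        (MvPolynomial.C c * MvPolynomial.X t)) 1 = if s = t then c else 0 := by
      intro c s t
      rw [MvPolynomial.pderiv_C_mul, MvPolynomial.pderiv_X, evalEntries, MvPolynomial.eval_mul,
        MvPolynomial.eval_C]
      by_cases h3 : s = t
      · subst h3
        simp
      · simp [h3, Ne.symm h3]
    have h3 : ∀ s, evalEntries (MvPolynomial.pderiv s (∑ k, (MvPolynomial.C (M i k) *
        MvPolynomial.X (k, j) - MvPolynomial.C (M k j) * MvPolynomial.X (i, k)))) 1 =
        ∑ k, ((if s = (k, j) then M i k else 0) - if s = (i, k) then M k j else 0) := by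
      intro s
      simp only [← h2]
      simp only [evalEntries, map_sum, map_sub]
    simp only [h3] at h1
    simp only [Finset.mul_sum, mul_sub, Finset.sum_sub_distrib, mul_ite, mul_zero] at h1
    rw [Finset.sum_comm, Finset.sum_comm (s := Finset.univ) (t := Finset.univ)
      (f := fun s k => if s = (i, k) then X s.1 s.2 * M k j else 0), sub_eq_zero] at h1
    simp only [Finset.sum_ite_eq', Finset.mem_univ, if_true] at h1
    rw [Matrix.mul_apply, Matrix.mul_apply, ← h1]
    exact Finset.sum_congr rfl fun k _ => mul_comm _ _
  have h2 := hXa x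
  change M * X * _ = _ at h2
  rw [hcomm, mul_assoc, ← Units.val_mul, mul_inv_cancel, Units.val_one, mul_one] at h2
  have h3 : ((point x (P.root i)) - 1) • X = 0 := by
    rw [sub_smul, one_smul, sub_eq_zero]
    exact h2.symm
  exact sub_eq_zero.mp ((smul_eq_zero.mp h3).resolve_right hX0)

section MulAut

variable {T X Y : Type*} [Group T] [AddCommGroup X] [AddCommGroup Y] (P : RootPairing ι ℤ X Y)
  (E : T ≃* AddChar X ℂ)

/-- The action of the Weyl group on the group of points, transported along an isomorphism. -/
def mulAutHom : P.weylGroup →* MulAut T :=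
  (MulAut.congr E).symm.toMonoidHom.comp (MulDistribMulAction.toMulAut P.weylGroup (AddChar X ℂ))

variable {P}

lemma apply_mulAutHom (w : P.weylGroup) (a : T) : E (mulAutHom P E w a) = w • E a :=
  E.apply_symm_apply _

lemma mulAutHom_apply_eq_mul_iff (w : P.weylGroup) (x a : T) :
    mulAutHom P E w a = x * a ↔ E a ∈ locus w (E x) := by
  rw [← E.injective.eq_iff, apply_mulAutHom, map_mul]
  rfl

end MulAut

namespace TorusCoordinates

variable {r : ℕ} (e : TorusCoordinates A r)

/-- A torus is the group of characters of its character group. -/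
def pointEquiv : A ≃* TorusPoint (Characters A) :=
  MulEquiv.ofBijective (MulHom.mk point point_mul) e.point_bijective

omit [IsMulCommutative A] in
lemma point_pointEquiv_symm (u : TorusPoint (Characters A)) : point (e.pointEquiv.symm u) = u :=
  e.pointEquiv.apply_symm_apply u

variable (P) in
/-- The action of the Weyl group of the root datum on the torus. -/
def weylHom : P.weylGroup →* MulAut A := mulAutHom P e.pointEquiv

lemma point_weylHom (w : P.weylGroup) (a : A) : point (e.weylHom P w a) = w • point a :=
  apply_mulAutHom e.pointEquiv w a

lemma weylHom_refl (hP : IsRootDatumOf G P) (i : ι) (a : A) :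
    e.weylHom P (refl P i) a = a * ((P.coroot i).1.toMul ((P.root i).1.toMul a))⁻¹ := by
  refine e.point_bijective.1 ?_
  rw [point_weylHom]
  ext χ
  have h1 := hP.pairing_eq χ (P.coroot i) ((P.root i).1.toMul a)
  rw [smul_point_apply, refl_inv, refl_smul, sub_eq_add_neg, ← neg_smul, AddChar.map_add_eq_mul,
    AddChar.map_zsmul_eq_zpow, point_apply, point_apply, point_apply, map_mul, map_inv, h1,
    ← zpow_neg, Units.val_mul, Units.val_zpow_eq_zpow_val]
  rfl

lemma range_weylHom (hP : IsRootDatumOf G P) : (e.weylHom P).range = weylGroup P := by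
  refine le_antisymm ?_ ((Subgroup.closure_le _).mpr ?_)
  · rintro _ ⟨⟨w, hw⟩, rfl⟩
    induction hw using weylGroup.induction with
    | mem i => exact Subgroup.subset_closure ⟨i, e.weylHom_refl hP i⟩
    | one =>
      have : e.weylHom P 1 ∈ weylGroup P := by
        rw [map_one]
        exact (weylGroup P).one_mem
      exact this
    | mul v w hv hw h1 h2 =>
      have := (weylGroup P).mul_mem h1 h2
      rwa [← map_mul] at this
  · rintro s ⟨i, hs⟩
    exact ⟨refl P i, MulEquiv.ext fun a => (e.weylHom_refl hP i a).trans (hs a).symm⟩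

/-- The action on the torus is faithful, since some point of the torus is regular. -/
lemma weylHom_injective [Finite ι] (h : IsDualWeightBasis b ϖ) :
    Function.Injective (e.weylHom P) := by
  have := Fintype.ofFinite ι
  have := h.finite_weylGroup
  have := Fintype.ofFinite P.weylGroup
  rw [injective_iff_map_eq_one]
  intro w hw
  refine h.isRegularPoint_of_forall_ne h.expPoint_deg_apply_root_ne_one w ?_
  obtain ⟨a, ha⟩ := e.point_bijective.2
    (expPoint ((Int.castAddHom ℂ).comp (IsDualWeightBasis.deg ϖ).toAddMonoidHom))
  rw [← ha, ← e.point_weylHom, hw]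
  rfl

include e in
lemma isRegular_iff [Finite ι] (hP : IsRootDatumOf G P) (h : IsDualWeightBasis b ϖ) (a : A) :
    IsRegular P a ↔ IsRegularPoint P (point a) := by
  rw [IsRegular, ← e.range_weylHom hP]
  constructor
  · intro H w hw
    refine e.weylHom_injective h ?_
    rw [map_one]
    refine H _ ⟨w, rfl⟩ (e.point_bijective.1 ?_)
    rw [e.point_weylHom, hw]
  · rintro H _ ⟨w, rfl⟩ hw
    rw [H w (by rw [← e.point_weylHom, hw]), map_one]

lemma mem_eigenLocus_weylHom {w : P.weylGroup} {x a : A} :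
    a ∈ eigenLocus (e.weylHom P w) x ↔ point a ∈ locus w (point x) :=
  mulAutHom_apply_eq_mul_iff e.pointEquiv w x a

lemma eigenLocus_weylHom (w : P.weylGroup) (x : A) :
    eigenLocus (e.weylHom P w) x = point ⁻¹' locus w (point x) :=
  Set.ext fun _ => e.mem_eigenLocus_weylHom

lemma zariskiDim_eigenLocus (h : IsDualWeightBasis b ϖ) (w : P.weylGroup) (x : A) :
    zariskiDim (eigenLocus (e.weylHom P w) x) = locusDim w (point x) := by
  rw [eigenLocus_weylHom]
  let _ := zariski A
  exact h.topologicalKrullDim_locus e.point_bijective.2 ⟨e.zariski_eq⟩ w (point x)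

lemma zariskiDim_eq_numTrivial_iff (h : IsDualWeightBasis b ϖ) (w : P.weylGroup) (x : A) :
    zariskiDim (eigenLocus (e.weylHom P w) x) = numTrivial ϖ x ↔
      locusDim w (point x) = ({i | point x (ϖ i) = 1} : Set b.support).ncard := by
  rw [e.zariskiDim_eigenLocus h]
  simp only [numTrivial, point_apply, Units.val_eq_one]

/-- Moving a point of a locus along a one-parameter subgroup whose direction is fixed does not leave
its connected component. -/
lemma exists_mem_zariskiComponent {w : P.weylGroup} {x v : A}
    (hv : v ∈ eigenLocus (e.weylHom P w) x) {z : Characters A →+ ℂ} (hz : z ∈ fixedSpace w) :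
    ∃ u ∈ zariskiComponent (eigenLocus (e.weylHom P w) x) v, point u = point v * expPoint z := by
  let γ : ℂ → A := fun t => e.pointEquiv.symm (point v * expPoint (t • z))
  have hγ : ∀ t, point (γ t) = point v * expPoint (t • z) := fun t => e.point_pointEquiv_symm _
  have hγ0 : γ 0 = v := by
    refine e.point_bijective.1 ?_
    rw [hγ, zero_smul]
    ext χ
    simp
  let _ := zariski A
  refine ⟨γ 1, ?_, by rw [hγ, one_smul]⟩
  refine (e.isPreconnected_range (point v) z hγ).subset_connectedComponentIn ⟨0, hγ0⟩ ?_ ⟨1, rfl⟩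
  rintro _ ⟨t, rfl⟩
  rw [eigenLocus_weylHom, Set.mem_preimage] at hv ⊢
  rw [hγ]
  exact mul_expPoint_mem_locus hv (Submodule.smul_mem _ t hz)

section Main

variable [Fintype ι] [Fintype P.weylGroup] (hP : IsRootDatumOf G P) (h : IsDualWeightBasis b ϖ)
  {x : A} (hx : IsCentralPoint P (point x)) {w : P.weylGroup}
include hP h hx

omit [Fintype ι] [Fintype P.weylGroup] hx in
lemma exists_isRegular_iff [Finite ι] : (∃ u ∈ eigenLocus (e.weylHom P w) x, IsRegular P u) ↔
    ∃ u ∈ locus w (point x), IsRegularPoint P u := by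
  rw [e.point_bijective.2.exists]
  exact exists_congr fun a => and_congr e.mem_eigenLocus_weylHom (e.isRegular_iff hP h a)

lemma exists_isRegular_of_zariskiDim
    (hdim : zariskiDim (eigenLocus (e.weylHom P w) x) = numTrivial ϖ x) :
    ∃ u ∈ eigenLocus (e.weylHom P w) x, IsRegular P u :=
  (e.exists_isRegular_iff hP h).mpr (h.exists_isRegularPoint_of_locusDim hx
    ((e.zariskiDim_eq_numTrivial_iff h w x).mp hdim))

lemma zariskiDim_of_isRegular {u : A} (hu : u ∈ eigenLocus (e.weylHom P w) x)
    (hur : IsRegular P u) : zariskiDim (eigenLocus (e.weylHom P w) x) = numTrivial ϖ x :=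
  (e.zariskiDim_eq_numTrivial_iff h w x).mpr
    (h.locusDim_eq hx (e.mem_eigenLocus_weylHom.mp hu) ((e.isRegular_iff hP h u).mp hur))

lemma exists_isRegular_mem_zariskiComponent {u v : A} (hu : u ∈ eigenLocus (e.weylHom P w) x)
    (hur : IsRegular P u) (hv : v ∈ eigenLocus (e.weylHom P w) x) :
    ∃ u' ∈ zariskiComponent (eigenLocus (e.weylHom P w) x) v, IsRegular P u' := by
  obtain ⟨z, hz, hvz⟩ := h.exists_mul_expPoint_of_isRegularPoint hx
    (e.mem_eigenLocus_weylHom.mp hu) ((e.isRegular_iff hP h u).mp hur)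
    (e.mem_eigenLocus_weylHom.mp hv)
  obtain ⟨u', hu', hpt⟩ := e.exists_mem_zariskiComponent hv hz
  rw [← hpt] at hvz
  exact ⟨u', hu', (e.isRegular_iff hP h u').mpr hvz⟩

end Main

variable (P) in
/-- The Weyl group of the root datum is isomorphic to the group of automorphisms of the torus that
is generated by the reflections. -/
def weylEquiv [Finite ι] (hP : IsRootDatumOf G P) (h : IsDualWeightBasis b ϖ) :
    P.weylGroup ≃* weylGroup P :=
  (MonoidHom.ofInjective (e.weylHom_injective h)).trans
    (MulEquiv.subgroupCongr (e.range_weylHom hP))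

end TorusCoordinates

end Group

end

end AlgTorus

theorem mainTheorem6 {N : ℕ} (G A : Subgroup (GL (Fin N) ℂ)) [IsMulCommutative A]
    (hG : AlgTorus.IsSimpleAlgebraicGroup G) (hA : AlgTorus.IsMaximalTorus G A)
    {ι : Type*} [Finite ι]
    (P : RootDatum ι (AlgTorus.Characters A) (AlgTorus.Cocharacters A))
    (hP : AlgTorus.IsRootDatumOf G P) (hsc : AlgTorus.IsSimplyConnected P)
    (b : P.Base) (ϖ : b.support → AlgTorus.Characters A)
    (hϖ : AlgTorus.IsFundamentalWeights P b ϖ)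
    (x : A) (hx : ∀ y ∈ G, (x : GL (Fin N) ℂ) * y = y * x) :
    (∀ g ∈ AlgTorus.weylGroup P,
      List.TFAE [
        AlgTorus.zariskiDim (AlgTorus.eigenLocus g x) = AlgTorus.numTrivial ϖ x,
        ∃ u ∈ AlgTorus.eigenLocus g x, AlgTorus.IsRegular P u,
        (AlgTorus.eigenLocus g x).Nonempty ∧
          ∀ v ∈ AlgTorus.eigenLocus g x,
            ∃ u ∈ AlgTorus.zariskiComponent (AlgTorus.eigenLocus g x) v,
              AlgTorus.IsRegular P u]) ∧
    ∃ g₀ : AlgTorus.weylGroup P, ∀ g : AlgTorus.weylGroup P,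
      (∃ u ∈ AlgTorus.eigenLocus (g : MulAut A) x, AlgTorus.IsRegular P u) ↔ IsConj g₀ g := by
  classical
  obtain ⟨-, r, φ, hφ1, hφ2⟩ := hA.torus
  let e : AlgTorus.TorusCoordinates A r := ⟨φ, hφ1, hφ2⟩
  have h := hϖ.isDualWeightBasis hsc
  have := Fintype.ofFinite ι
  have := h.finite_weylGroup
  have := Fintype.ofFinite P.weylGroup
  have hxc := AlgTorus.isCentralPoint_point hP hx
  refine ⟨fun g hg => ?_, ?_⟩
  · obtain ⟨w, hw⟩ := (e.weylEquiv P hP h).surjective ⟨g, hg⟩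
    obtain rfl : e.weylHom P w = g := congrArg Subtype.val hw
    tfae_have 1 → 2 := e.exists_isRegular_of_zariskiDim hP h hxc
    tfae_have 2 → 1 := by
      rintro ⟨u, hu, hur⟩
      exact e.zariskiDim_of_isRegular hP h hxc hu hur
    tfae_have 2 → 3 := by
      rintro ⟨u, hu, hur⟩
      exact ⟨⟨u, hu⟩, fun v hv => e.exists_isRegular_mem_zariskiComponent hP h hxc hu hur hv⟩
    tfae_have 3 → 2 := by
      rintro ⟨⟨v, hv⟩, H⟩
      obtain ⟨u, hu, hur⟩ := H v hv
      let _ := AlgTorus.zariski A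
      exact ⟨u, connectedComponentIn_subset _ _ hu, hur⟩
    tfae_finish
  · obtain ⟨w₀, hw₀⟩ := h.exists_forall_isRegularPoint_iff_isConj hxc
    refine ⟨e.weylEquiv P hP h w₀, fun g => ?_⟩
    obtain ⟨w, rfl⟩ := (e.weylEquiv P hP h).surjective g
    refine ((e.exists_isRegular_iff hP h).trans (hw₀ w)).trans
      ⟨fun hc => (e.weylEquiv P hP h).toMonoidHom.map_isConj hc, fun hc => ?_⟩
    simpa using (e.weylEquiv P hP h).symm.toMonoidHom.map_isConj hc
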